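/- Let $G$ be a finite graph without loops, in which multiple edges are allowed. Suppose that $G$ is 4-edge-connected, i.e. $G-S$ is connected for every set $S$ of fewer than four edges of $G$ (a connected graph has at least one vertex). For $X\subseteq V(G)$ let $\partial_G(X)$ be the set of edges with one end in $X$ and the other in $V(G)\setminus X$, and call an edge set $C$ a 5-edge-cut if $C=\partial_G(X)$ for some $X\subseteq V(G)$ and $|C|=5$. If $G$ has at most seven distinct 5-edge-cuts, then $G$ admits a nowhere-zero 3-flow: there are an orientation $D$ of the edges of $G$ and a function $f:E(G)\to\{\pm1,\pm2\}$ such that, for every vertex $v\in V(G)$, the sum of $f(e)$ over the edges $e$ directed out of $v$ by $D$ equals the sum of $f(e)$ over the edges $e$ directed into $v$ by $D$. -/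

import Mathlib

open scoped Graph

namespace Graph

variable {α β : Type*}

/-- A multigraph is connected if it has a vertex and any two of its vertices are joined by a
(possibly trivial) walk, that is, a finite chain of consecutively adjacent vertices. -/
structure IsConnected (G : Graph α β) : Prop where
  nonempty : V(G).Nonempty
  joined : ∀ x ∈ V(G), ∀ y ∈ V(G), Relation.ReflTransGen G.Adj x y

/-- `G` is `k`-edge-connected: `G - S` is connected for each set `S` of fewer than `k` edges. -/
def IsEdgeConnected (G : Graph α β) (k : ℕ) : Prop :=
  ∀ S ⊆ E(G), S.encard < k → (G.deleteEdges S).IsConnected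

/-- The edge-cut `∂(X)`: the edges with one end in `X` and the other end in `V(G) \ X`. -/
def edgeCut (G : Graph α β) (X : Set α) : Set β :=
  {e | ∃ x ∈ X, ∃ y ∈ V(G) \ X, G.IsLink e x y}

/-- The `k`-edge-cuts of `G`, as a set of edge sets: all `C = ∂(X)` with `X ⊆ V(G)`, `|C| = k`. -/
def edgeCutsOfSize (G : Graph α β) (k : ℕ) : Set (Set β) :=
  {C | C.encard = k ∧ ∃ X ⊆ V(G), C = G.edgeCut X}

/-- An orientation of `G`: every edge gets a tail and a head, which are its two ends. -/
structure EdgeOrientation (G : Graph α β) where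
  tail : E(G) → α
  head : E(G) → α
  isLink : ∀ e : E(G), G.IsLink e (tail e) (head e)

/-- `(D, f)` is a nowhere-zero `3`-flow: `f` takes values in `{±1, ±2}`, and at every vertex the
sum of `f` over the outgoing arcs equals the sum over the incoming arcs.
(The sums are `finsum`s; `G` will have finitely many edges.) -/
structure IsNowhereZeroThreeFlow (G : Graph α β) (D : G.EdgeOrientation) (f : E(G) → ℤ) :
    Prop where
  mem_values : ∀ e, f e ∈ ({1, -1, 2, -2} : Set ℤ)
  balanced : ∀ v ∈ V(G), ∑ᶠ e ∈ {e | D.tail e = v}, f e = ∑ᶠ e ∈ {e | D.head e = v}, f e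

end Graph

/-! It suffices to orient the edges so that every net out-degree is divisible by 3. This is a flow
modulo 3 with all values 1, and Tutte's path-reversal argument (`exists_integer_flow`) turns it into
an integer flow with values 1 and -2.

The orientation comes from the modulo 3 orientation theorem (`Admissible.orientable`), in which all
arcs at a root outside `W` are fixed in advance. Working modulo 6 records a boundary modulo 3
together with the parity of the degree. The theorem needs every nonempty proper subset of `W` to
have cut weight at least 4 plus `norm6` of its boundary, and the root to have degree at most 4 plus
`norm6` of its own. A set left by d edges has boundary 3d modulo 6, so in a 4-edge-connected graph
only d = 5 violates the condition, as 7 would be needed. Root arcs ending in such a set repair it: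
one arc gives weight 6 and a boundary of norm 2. The root may have degree 7 = 4 + 3, with five arcs
out and two in, so seven vertices meeting every side of every 5-edge-cut are enough.
Inclusion-minimal sides are pairwise disjoint by submodularity and parity
(`disjoint_of_minimal_side`), and if there are more than two of them they have distinct cuts. Hence
there are at most seven.

The orientation theorem is proved by induction on the number of vertices, then on `edgeSize`. A
tight cut around at least two vertices, a pair of parallel edges, or a vertex of degree 4 leads to
fewer vertices. Otherwise parity gives slack 2 at every proper set of at least two vertices, so an
edge can be deleted unless all vertices are tight with boundaries of the same sign. In that last
case the arcs at the root are altered as well, which again gives a smaller instance. -/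

/-- The distance from an integer to the nearest multiple of `6`. -/
def norm6 (b : ℤ) : ℤ := min (b % 6) (6 - b % 6)

/-! ### Weighted multigraphs with a root, and orientations modulo 6. -/

section Weights

variable {α : Type*} [DecidableEq α]

/-- The weight of the edges leaving `A`, in the graph on `W` with edge multiplicities `m` and
with `s x` edges from `x` to a root outside `W`. -/
def cutWeight (W : Finset α) (m : α → α → ℤ) (s : α → ℤ) (A : Finset α) : ℤ :=
  ∑ x ∈ A, ∑ y ∈ W \ A, m x y + ∑ x ∈ A, s x

/-- The multiplicity matrix of a single arc. -/
def arc (x y u v : α) : ℤ := if u = x ∧ v = y then 1 else 0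

/-- The multiplicity matrix of a single edge. -/
def link (x y u v : α) : ℤ := arc x y u v + arc y x u v

/-- The edges of the graph on `W` with multiplicities `m` can be oriented so that the net
out-degree of each vertex `x` is congruent to `c x` modulo `6`. -/
def Orientable (W : Finset α) (m : α → α → ℤ) (c : α → ℤ) : Prop :=
  ∃ o : α → α → ℤ, (∀ x ∈ W, ∀ y ∈ W, 0 ≤ o x y) ∧
    (∀ x ∈ W, ∀ y ∈ W, o x y + o y x = m x y) ∧
    ∀ x ∈ W, 6 ∣ c x - ∑ y ∈ W, (o x y - o y x)

/-- The data of the modulo `3` orientation theorem: `m` gives the multiplicities of the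
edges on `W`, while `p x` and `q x` count the arcs from a root to `x` and from `x` to the root;
the net out-degree of `x` is prescribed to be `b x` modulo `6`. -/
structure PreAdmissible (W : Finset α) (m : α → α → ℤ) (p q b : α → ℤ) : Prop where
  symm : ∀ x y, m x y = m y x
  diag : ∀ x, m x x = 0
  nonneg : ∀ x y, 0 ≤ m x y
  p_nonneg : ∀ x ∈ W, 0 ≤ p x
  q_nonneg : ∀ x ∈ W, 0 ≤ q x
  sum : 6 ∣ ∑ x ∈ W, b x + ∑ x ∈ W, p x - ∑ x ∈ W, q x
  root : ∑ x ∈ W, p x + ∑ x ∈ W, q x ≤ 4 + norm6 (∑ x ∈ W, p x - ∑ x ∈ W, q x)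
  parity : ∀ A ⊆ W, 2 ∣ cutWeight W m (p + q) A - ∑ x ∈ A, b x

/-- The hypotheses of the modulo `3` orientation theorem. -/
structure Admissible (W : Finset α) (m : α → α → ℤ) (p q b : α → ℤ) : Prop
    extends PreAdmissible W m p q b where
  cut : ∀ A ⊆ W, A.Nonempty → A ≠ W → 4 + norm6 (∑ x ∈ A, b x) ≤ cutWeight W m (p + q) A

theorem arc_nonneg (x y u v : α) : 0 ≤ arc x y u v := by
  unfold arc; split_ifs <;> norm_num

theorem sum_arc {A B : Finset α} (x y : α) :
    ∑ u ∈ A, ∑ v ∈ B, arc x y u v = if x ∈ A ∧ y ∈ B then 1 else 0 := by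
  have h : ∀ u v, arc x y u v = (if u = x then (1 : ℤ) else 0) * (if v = y then 1 else 0) := by
    intro u v; unfold arc; split_ifs <;> simp_all
  simp only [h, ← Finset.mul_sum, ← Finset.sum_mul, Finset.sum_ite_eq']
  split_ifs <;> simp_all

theorem sum_arc_row {W : Finset α} {x y : α} (hx : x ∈ W) (hy : y ∈ W) (u : α) :
    ∑ v ∈ W, (arc x y u v - arc x y v u) =
      (if u = x then 1 else 0) - (if u = y then 1 else 0) := by
  have h1 : ∑ v ∈ W, arc x y u v = if u = x then 1 else 0 := by
    by_cases h : u = x <;> simp [arc, h, hy]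
  have h2 : ∑ v ∈ W, arc x y v u = if u = y then 1 else 0 := by
    by_cases h : u = y <;> simp [arc, h, hx]
  rw [Finset.sum_sub_distrib, h1, h2]

theorem link_symm (x y u v : α) : link x y u v = link x y v u := by
  simp only [link, arc, and_comm, add_comm]

theorem link_diag {x y : α} (h : x ≠ y) (u : α) : link x y u u = 0 := by
  have h1 : ¬ (u = x ∧ u = y) := fun e => h (e.1.symm.trans e.2)
  have h2 : ¬ (u = y ∧ u = x) := fun e => h (e.2.symm.trans e.1)
  rw [link, arc, arc, if_neg h1, if_neg h2, add_zero]

theorem link_apply_left {x y : α} (h : x ≠ y) (u : α) : link x y x u = if u = y then 1 else 0 := by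
  unfold link arc; split_ifs <;> simp_all

theorem link_nonneg (x y u v : α) : 0 ≤ link x y u v :=
  add_nonneg (arc_nonneg ..) (arc_nonneg ..)

theorem link_le {m : α → α → ℤ} (hs : ∀ x y, m x y = m y x) (h0 : ∀ x y, 0 ≤ m x y) {x y : α}
    (h : x ≠ y) (hm : 1 ≤ m x y) (u v : α) : link x y u v ≤ m u v := by
  unfold link arc
  by_cases h1 : u = x ∧ v = y
  · obtain ⟨rfl, rfl⟩ := h1
    simpa [h] using hm
  · by_cases h2 : u = y ∧ v = x
    · obtain ⟨rfl, rfl⟩ := h2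
      simpa [h.symm, hs u v] using hm
    · rw [if_neg h1, if_neg h2]; exact h0 u v

theorem sum_link_cut {W A : Finset α} {x y : α} (hx : x ∈ W) (hy : y ∈ W) :
    ∑ u ∈ A, ∑ v ∈ W \ A, link x y u v =
      (if x ∈ A ∧ y ∉ A then 1 else 0) + (if y ∈ A ∧ x ∉ A then 1 else 0) := by
  simp only [link, Finset.sum_add_distrib, sum_arc, Finset.mem_sdiff, hx, hy, true_and]

theorem sum_single {A : Finset α} (x : α) (t : ℤ) :
    ∑ u ∈ A, (Pi.single x t : α → ℤ) u = if x ∈ A then t else 0 := by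
  simp [Pi.single_apply]

theorem Orientable.congr {α : Type*} {W : Finset α} {m : α → α → ℤ} {c c' : α → ℤ}
    (h : Orientable W m c) (hc : ∀ x ∈ W, 6 ∣ c' x - c x) : Orientable W m c' := by
  obtain ⟨o, h0, h1, h2⟩ := h
  refine ⟨o, h0, h1, fun x hx => ?_⟩
  have := dvd_add (hc x hx) (h2 x hx)
  rwa [show c' x - c x + (c x - ∑ y ∈ W, (o x y - o y x)) =
    c' x - ∑ y ∈ W, (o x y - o y x) by ring] at this

theorem Orientable.add_arc {W : Finset α} {m : α → α → ℤ} {c : α → ℤ} {x y : α}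
    (hx : x ∈ W) (hy : y ∈ W)
    (h : Orientable W (m - link x y) (c - Pi.single x 1 + Pi.single y 1)) :
    Orientable W m c := by
  obtain ⟨o, h0, h1, h2⟩ := h
  refine ⟨o + arc x y, fun u hu v hv => add_nonneg (h0 u hu v hv) (arc_nonneg ..),
    fun u hu v hv => ?_, fun u hu => ?_⟩
  · have := h1 u hu v hv
    have e : arc x y v u = arc y x u v := by simp only [arc, and_comm]
    simp only [Pi.sub_apply, link] at this
    simp only [Pi.add_apply, e]; linarith
  · have := h2 u hu
    have e := sum_arc_row hx hy u
    have e2 : ∑ v ∈ W, ((o + arc x y) u v - (o + arc x y) v u) =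
        ∑ v ∈ W, (o u v - o v u) + ∑ v ∈ W, (arc x y u v - arc x y v u) := by
      rw [← Finset.sum_add_distrib]
      exact Finset.sum_congr rfl fun v _ => by simp only [Pi.add_apply]; ring
    rw [e2, e]
    simp only [Pi.add_apply, Pi.sub_apply, Pi.single_apply] at this
    convert this using 1; ring

/-- Reversing all arcs. -/
theorem Orientable.neg {α : Type*} {W : Finset α} {m : α → α → ℤ} {c : α → ℤ} (h : Orientable W m c) :
    Orientable W m (-c) := by
  obtain ⟨o, h0, h1, h2⟩ := h
  refine ⟨fun x y => o y x, fun x hx y hy => h0 y hy x hx,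
    fun x hx y hy => by rw [add_comm]; exact h1 x hx y hy, fun x hx => ?_⟩
  have := (dvd_neg (a := (6 : ℤ))).2 (h2 x hx)
  simp only [Finset.sum_sub_distrib, Pi.neg_apply] at this ⊢
  rwa [show -(c x - (∑ y ∈ W, o x y - ∑ y ∈ W, o y x)) =
    -c x - (∑ y ∈ W, o y x - ∑ y ∈ W, o x y) by ring] at this

/-- Undoing the lift of the edges `x v` and `v y` to an edge `x y`. -/
theorem Orientable.of_lift {W : Finset α} {m : α → α → ℤ} {c : α → ℤ} {x y v : α}
    (hm : ∀ x y, 0 ≤ m x y) (hx : x ∈ W) (hy : y ∈ W) (hv : v ∈ W) (hxy : x ≠ y) (hvx : v ≠ x)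
    (hvy : v ≠ y) (h : Orientable W (m - link x v - link v y + link x y) c) :
    Orientable W m c := by
  obtain ⟨o, h0, h1, h2⟩ := h
  -- One arc from `s` to `t` is rerouted through `v`, which does not change any net out-degree. The
  -- lifted graph has an `x y` edge, so such an arc exists in one of the two directions.
  have key : ∀ s t : α, s ∈ W → t ∈ W → 1 ≤ o s t →
      (∀ i j, link s v i j + link v t i j - link s t i j =
        link x v i j + link v y i j - link x y i j) → Orientable W m c := by
    intro s t hs ht hst hl
    refine ⟨o + arc s v + arc v t - arc s t, fun u hu w hw => ?_, fun u hu w hw => ?_,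
      fun u hu => ?_⟩
    · have := h0 u hu w hw
      have := arc_nonneg s v u w
      have := arc_nonneg v t u w
      have : arc s t u w ≤ o u w := by
        unfold arc; split_ifs with h
        · rw [h.1, h.2]; exact hst
        · exact h0 u hu w hw
      simp only [Pi.add_apply, Pi.sub_apply]; linarith
    · have e := h1 u hu w hw
      have := hl u w
      have hc : ∀ i j, arc i j w u = arc j i u w := fun i j => by simp only [arc, and_comm]
      simp only [Pi.add_apply, Pi.sub_apply, hc] at e ⊢
      simp only [link] at this e
      linarith
    · have e2 : ∑ w ∈ W, ((o + arc s v + arc v t - arc s t) u w -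
          (o + arc s v + arc v t - arc s t) w u) = ∑ w ∈ W, (o u w - o w u) +
          ∑ w ∈ W, (arc s v u w - arc s v w u) + ∑ w ∈ W, (arc v t u w - arc v t w u) -
          ∑ w ∈ W, (arc s t u w - arc s t w u) := by
        rw [← Finset.sum_add_distrib, ← Finset.sum_add_distrib, ← Finset.sum_sub_distrib]
        exact Finset.sum_congr rfl fun w _ => by simp only [Pi.add_apply, Pi.sub_apply]; ring
      rw [e2, sum_arc_row hs hv, sum_arc_row hv ht, sum_arc_row hs ht]
      convert h2 u hu using 1; ring
  have e := h1 x hx y hy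
  have : link x v x y = 0 := by rw [link_apply_left hvx.symm, if_neg hvy.symm]
  have h3 : link v y x y = 0 := by
    unfold link arc; simp [hvx.symm, hxy]
  simp only [Pi.add_apply, Pi.sub_apply, this, h3, link_apply_left hxy, if_true] at e
  have := hm x y
  rcases (by omega : 1 ≤ o x y ∨ 1 ≤ o y x) with h | h
  · exact key x y hx hy h fun i j => rfl
  · exact key y x hy hx h fun i j => by simp only [link]; ring

theorem orientable_pair {m : α → α → ℤ} {c : α → ℤ} {x y : α} (hxy : x ≠ y)
    (hs : m x y = m y x) (hx : m x x = 0) (hy : m y y = 0) {r : ℤ} (hr : 0 ≤ r)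
    (hrm : r ≤ m x y) (hc : 6 ∣ c x - (2 * r - m x y)) (hsum : 6 ∣ c x + c y) :
    Orientable {x, y} m c := by
  refine ⟨fun u v => if u = x ∧ v = y then r else if u = y ∧ v = x then m x y - r else 0, ?_, ?_, ?_⟩
  · intro u _ v _; dsimp only; split_ifs <;> omega
  · simp [hxy, hxy.symm, hs, hx, hy]
  · simp only [Finset.mem_insert, Finset.mem_singleton, forall_eq_or_imp, forall_eq,
      Finset.sum_pair hxy]
    simp only [hxy, hxy.symm, and_self, and_false, false_and, if_true, if_false]
    omega

end Weights

/-- Greedy filling of capacities. It distributes the arcs at a contracted vertex among the original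
edges. -/
theorem exists_sum_eq_of_le {α : Type*} [DecidableEq α] (s : Finset α) (u : α → ℤ) (t : ℤ)
    (hu : ∀ x ∈ s, 0 ≤ u x) (h0 : 0 ≤ t) (ht : t ≤ ∑ x ∈ s, u x) :
    ∃ r : α → ℤ, (∀ x ∈ s, 0 ≤ r x ∧ r x ≤ u x) ∧ ∑ x ∈ s, r x = t := by
  induction s using Finset.induction_on generalizing t with
  | empty => exact ⟨0, by simp, by simp at ht ⊢; omega⟩
  | insert a s ha ih =>
    rw [Finset.sum_insert ha] at ht
    have hua := hu a (Finset.mem_insert_self ..)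
    obtain ⟨r, hr, hs⟩ := ih (t - min t (u a)) (fun x hx => hu x (Finset.mem_insert_of_mem hx))
      (by omega) (by
        have := Finset.sum_nonneg fun x hx => hu x (Finset.mem_insert_of_mem (a := x) (b := a) hx)
        omega)
    have hne : ∀ x ∈ s, x ≠ a := fun x hx e => ha (e ▸ hx)
    refine ⟨Function.update r a (min t (u a)), fun x hx => ?_, ?_⟩
    · rcases Finset.mem_insert.1 hx with rfl | hx
      · rw [Function.update_self]; omega
      · rw [Function.update_of_ne (hne x hx)]; exact hr x hx
    · rw [Finset.sum_insert ha, Function.update_self, Finset.sum_congr rfl fun x hx =>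
        Function.update_of_ne (hne x hx) _ _, hs]
      ring

/-! ### Contracting a vertex set, and lifting orientations back. -/

section Contraction

variable {α : Type*} [DecidableEq α]

/-- The vertices merged into `u` when the set `A` is contracted to the vertex `a`. -/
def fiber (A : Finset α) (a u : α) : Finset α := if u = a then A else {u}

/-- The edge multiplicities after contracting `A` to `a`. -/
def contractMul (A : Finset α) (a : α) (m : α → α → ℤ) (u v : α) : ℤ :=
  if u = v then 0 else ∑ x ∈ fiber A a u, ∑ y ∈ fiber A a v, m x y

/-- The vertex weights after contracting `A` to `a`. -/
def contractFun (A : Finset α) (a : α) (f : α → ℤ) (u : α) : ℤ := ∑ x ∈ fiber A a u, f x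

theorem fiber_self (A : Finset α) (a : α) : fiber A a a = A := if_pos rfl

theorem fiber_of_ne (A : Finset α) {a u : α} (h : u ≠ a) : fiber A a u = {u} := if_neg h

theorem ne_of_mem_sdiff {W A : Finset α} {a v : α} (ha : a ∈ A) (hv : v ∈ W \ A) : v ≠ a :=
  fun e => (Finset.mem_sdiff.1 hv).2 (e ▸ ha)

theorem pairwiseDisjoint_fiber {W A B : Finset α} {a : α} (hB : B ⊆ insert a (W \ A)) :
    (B : Set α).PairwiseDisjoint (fiber A a) := by
  intro u hu v hv huv
  have hu' := Finset.mem_insert.1 (hB hu)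
  have hv' := Finset.mem_insert.1 (hB hv)
  simp only [Finset.mem_sdiff] at hu' hv'
  simp only [Function.onFun, fiber]
  split_ifs with h1 h2 h2
  · exact absurd (h1.trans h2.symm) huv
  · exact Finset.disjoint_singleton_right.2 (hv'.resolve_left h2).2
  · exact Finset.disjoint_singleton_left.2 (hu'.resolve_left h1).2
  · simpa using huv

theorem mem_biUnion_fiber {W A B : Finset α} {a x : α} (ha : a ∈ A)
    (hB : B ⊆ insert a (W \ A)) :
    x ∈ B.biUnion (fiber A a) ↔ if x ∈ A then a ∈ B else x ∈ B := by
  simp only [Finset.mem_biUnion]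
  constructor
  · rintro ⟨u, hu, hx⟩
    have hu' := Finset.mem_insert.1 (hB hu)
    by_cases h : u = a
    · subst h; rw [fiber_self] at hx; rwa [if_pos hx]
    · rw [fiber_of_ne A h, Finset.mem_singleton] at hx
      subst hx
      rwa [if_neg (Finset.mem_sdiff.1 (hu'.resolve_left h)).2]
  · have hxa : x ∉ A → x ≠ a := fun h e => h (e ▸ ha)
    split_ifs with h
    · exact fun haB => ⟨a, haB, by rwa [fiber_self]⟩
    · exact fun hx => ⟨x, hx, by rw [fiber_of_ne A (hxa h)]; simp⟩

theorem biUnion_fiber_subset {W A B : Finset α} {a : α} (hA : A ⊆ W) (ha : a ∈ A)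
    (hB : B ⊆ insert a (W \ A)) : B.biUnion (fiber A a) ⊆ W := by
  intro x hx
  rw [mem_biUnion_fiber ha hB] at hx
  split_ifs at hx with h
  · exact hA h
  · have := Finset.mem_insert.1 (hB hx)
    rcases this with rfl | h'
    · exact hA ha
    · exact (Finset.mem_sdiff.1 h').1

theorem biUnion_fiber_sdiff {W A B : Finset α} {a : α} (hA : A ⊆ W) (ha : a ∈ A)
    (hB : B ⊆ insert a (W \ A)) :
    (insert a (W \ A) \ B).biUnion (fiber A a) = W \ B.biUnion (fiber A a) := by
  ext x
  rw [Finset.mem_sdiff, mem_biUnion_fiber ha Finset.sdiff_subset, mem_biUnion_fiber ha hB]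
  by_cases h : x ∈ A
  · simp [h, hA h]
  · have : x ≠ a := fun e => h (e ▸ ha)
    simp [h, this]

theorem sum_contractFun {W A B : Finset α} {a : α} (hB : B ⊆ insert a (W \ A)) (f : α → ℤ) :
    ∑ u ∈ B, contractFun A a f u = ∑ x ∈ B.biUnion (fiber A a), f x :=
  (Finset.sum_biUnion (pairwiseDisjoint_fiber hB)).symm

theorem biUnion_fiber_univ {W A : Finset α} {a : α} (hA : A ⊆ W) (ha : a ∈ A) :
    (insert a (W \ A)).biUnion (fiber A a) = W := by
  have := biUnion_fiber_sdiff (B := ∅) hA ha (Finset.empty_subset _)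
  simpa using this

theorem cutWeight_contract {W A B : Finset α} {a : α} (hA : A ⊆ W) (ha : a ∈ A)
    (hB : B ⊆ insert a (W \ A)) (m : α → α → ℤ) (s : α → ℤ) :
    cutWeight (insert a (W \ A)) (contractMul A a m) (contractFun A a s) B =
      cutWeight W m s (B.biUnion (fiber A a)) := by
  unfold cutWeight
  rw [sum_contractFun hB]
  congr 1
  rw [← biUnion_fiber_sdiff hA ha hB,
    Finset.sum_biUnion (pairwiseDisjoint_fiber hB)]
  refine Finset.sum_congr rfl fun u hu => ?_
  rw [Finset.sum_congr rfl fun x _ => Finset.sum_biUnion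
    (pairwiseDisjoint_fiber (W := W) Finset.sdiff_subset), Finset.sum_comm]
  refine Finset.sum_congr rfl fun v hv => ?_
  rw [contractMul, if_neg]
  exact fun e => (Finset.mem_sdiff.1 hv).2 (e ▸ hu)

/-- Cuts of the contraction are the cuts of the original graph that do not split `A`, so the cut
condition is needed only for those. The reductions below exploit this: after a lift the condition
may fail for sets splitting the pair to be contracted. -/
theorem PreAdmissible.contract {W A : Finset α} {m : α → α → ℤ} {p q b : α → ℤ} {a : α}
    (h : PreAdmissible W m p q b) (hA : A ⊆ W) (ha : a ∈ A)
    (hcut : ∀ B ⊆ W, B.Nonempty → B ≠ W → A ⊆ B ∨ Disjoint A B →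
      4 + norm6 (∑ x ∈ B, b x) ≤ cutWeight W m (p + q) B) :
    Admissible (insert a (W \ A)) (contractMul A a m) (contractFun A a p) (contractFun A a q)
      (contractFun A a b) := by
  have hW := biUnion_fiber_univ hA ha
  have hs := fun f : α → ℤ => sum_contractFun (a := a) (A := A) (W := W) subset_rfl f
  rw [hW] at hs
  have hpq : contractFun A a p + contractFun A a q = contractFun A a (p + q) := by
    ext u; simp [contractFun, Finset.sum_add_distrib]
  have hf : ∀ u ∈ insert a (W \ A), ∀ x ∈ fiber A a u, x ∈ W := fun u hu x hx =>
    biUnion_fiber_subset hA ha subset_rfl (Finset.mem_biUnion.2 ⟨u, hu, hx⟩)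
  refine ⟨⟨fun x y => ?_, fun x => if_pos rfl, fun x y => ?_, fun x hx => ?_, fun x hx => ?_, ?_,
    ?_, fun B hB => ?_⟩, fun B hB hne hBW => ?_⟩
  · unfold contractMul
    rw [Finset.sum_comm]
    simp only [h.symm, eq_comm]
  · unfold contractMul
    split_ifs
    · rfl
    · exact Finset.sum_nonneg fun _ _ => Finset.sum_nonneg fun _ _ => h.nonneg _ _
  · exact Finset.sum_nonneg fun y hy => h.p_nonneg y (hf x hx y hy)
  · exact Finset.sum_nonneg fun y hy => h.q_nonneg y (hf x hx y hy)
  · rw [hs, hs, hs]; exact h.sum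
  · rw [hs, hs]; exact h.root
  · rw [hpq, cutWeight_contract hA ha hB, sum_contractFun hB]
    exact h.parity _ (biUnion_fiber_subset hA ha hB)
  · rw [hpq, cutWeight_contract hA ha hB, sum_contractFun hB]
    refine hcut _ (biUnion_fiber_subset hA ha hB) ?_ (fun e => ?_) ?_
    · obtain ⟨u, hu⟩ := hne
      by_cases hua : u = a
      · exact ⟨a, Finset.mem_biUnion.2 ⟨u, hu, by rwa [hua, fiber_self]⟩⟩
      · exact ⟨u, Finset.mem_biUnion.2 ⟨u, hu, by simp [fiber_of_ne A hua]⟩⟩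
    · refine hBW (Finset.Subset.antisymm hB fun u hu => ?_)
      rcases Finset.mem_insert.1 hu with rfl | hu
      · have := (mem_biUnion_fiber ha hB).1 (e ▸ hA ha); rwa [if_pos ha] at this
      · have hu' := Finset.mem_sdiff.1 hu
        have := (mem_biUnion_fiber ha hB).1 (e ▸ hu'.1); rwa [if_neg hu'.2] at this
    · by_cases haB : a ∈ B
      · exact Or.inl fun x hx => (mem_biUnion_fiber ha hB).2 (by rwa [if_pos hx])
      · refine Or.inr (Finset.disjoint_left.2 fun x hx hx' => haB ?_)
        have := (mem_biUnion_fiber ha hB).1 hx'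
        rwa [if_pos hx] at this

/-- An orientation of the contracted graph gives the arcs between `A` and its complement;
what remains is to orient the edges inside `A`. -/
theorem Orientable.of_contract {W A : Finset α} {m : α → α → ℤ} {c : α → ℤ} {a : α}
    (hs : ∀ x y, m x y = m y x) (hd : ∀ x, m x x = 0) (h0 : ∀ x y, 0 ≤ m x y) (hA : A ⊆ W) (ha : a ∈ A)
    (h : Orientable (insert a (W \ A)) (contractMul A a m) (contractFun A a c)) :
    ∃ r : α → α → ℤ, (∀ x ∈ A, ∀ v ∈ W \ A, 0 ≤ r x v ∧ r x v ≤ m x v) ∧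
      6 ∣ ∑ x ∈ A, (c x - ∑ v ∈ W \ A, (2 * r x v - m x v)) ∧
      (Orientable A m (fun x => c x - ∑ v ∈ W \ A, (2 * r x v - m x v)) → Orientable W m c) := by
  obtain ⟨o, o0, o1, o2⟩ := h
  have haW : a ∈ insert a (W \ A) := Finset.mem_insert_self ..
  have hma : ∀ v ∈ W \ A, contractMul A a m a v = ∑ x ∈ A, m x v := fun v hv => by
    have hva := ne_of_mem_sdiff ha hv
    rw [contractMul, if_neg hva.symm, fiber_self, fiber_of_ne A hva]; simp
  have hanot : a ∉ W \ A := fun h => (Finset.mem_sdiff.1 h).2 ha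
  -- The arcs from `a` to `v` are shared out among the edges joining `A` to `v`; `r x` of the `x v`
  -- edges will leave `x`.
  have hsplit : ∀ v : α, ∃ r : α → ℤ, v ∈ W \ A →
      (∀ x ∈ A, 0 ≤ r x ∧ r x ≤ m x v) ∧ ∑ x ∈ A, r x = o a v := fun v => by
    by_cases hv : v ∈ W \ A
    · have hvW := Finset.mem_insert_of_mem (b := a) hv
      have := o1 a haW v hvW
      have := o0 v hvW a haW
      obtain ⟨r, hr⟩ := exists_sum_eq_of_le A (fun x => m x v) (o a v) (fun x _ => h0 x v)
        (o0 a haW v hvW) (by rw [← hma v hv]; linarith)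
      exact ⟨r, fun _ => hr⟩
    · exact ⟨0, fun h => absurd h hv⟩
  choose r hr using hsplit
  refine ⟨fun x v => r v x, fun x hx v hv => (hr v hv).1 x hx, ?_, ?_⟩
  · have := o2 a haW
    rw [contractFun, fiber_self, Finset.sum_insert hanot, sub_self, zero_add] at this
    rw [Finset.sum_sub_distrib, Finset.sum_comm]
    convert this using 2
    refine Finset.sum_congr rfl fun v hv => ?_
    rw [Finset.sum_sub_distrib, ← Finset.mul_sum, (hr v hv).2, ← hma v hv,
      ← o1 a haW v (Finset.mem_insert_of_mem hv)]
    ring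
  · rintro ⟨g, g0, g1, g2⟩
    have hmem : ∀ u ∈ W, u ∉ A → u ∈ W \ A := fun u hu hn => Finset.mem_sdiff.2 ⟨hu, hn⟩
    refine ⟨fun u v => if u ∈ A then (if v ∈ A then g u v else r v u) else
      (if v ∈ A then m v u - r u v else o u v), fun u hu v hv => ?_, fun u hu v hv => ?_,
      fun u hu => ?_⟩
    · dsimp only
      split_ifs with h1 h2 h2
      · exact g0 u h1 v h2
      · exact ((hr v (hmem v hv h2)).1 u h1).1
      · exact sub_nonneg.2 ((hr u (hmem u hu h1)).1 v h2).2
      · exact o0 u (Finset.mem_insert_of_mem (hmem u hu h1)) v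
          (Finset.mem_insert_of_mem (hmem v hv h2))
    · dsimp only
      by_cases h1 : u ∈ A <;> by_cases h2 : v ∈ A <;> simp only [h1, h2, if_true, if_false]
      · exact g1 u h1 v h2
      · ring
      · rw [hs v u]; ring
      · rw [o1 u (Finset.mem_insert_of_mem (hmem u hu h1)) v
          (Finset.mem_insert_of_mem (hmem v hv h2)), contractMul]
        split_ifs with e
        · subst e
          exact (hd u).symm
        · rw [fiber_of_ne A (ne_of_mem_sdiff ha (hmem u hu h1)),
            fiber_of_ne A (ne_of_mem_sdiff ha (hmem v hv h2))]; simp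
    · rw [← Finset.sum_sdiff hA]
      by_cases h1 : u ∈ A
      · have := g2 u h1
        simp only [h1, if_true]
        have e1 : ∑ x ∈ A, ((if x ∈ A then g u x else r x u) -
            if x ∈ A then g x u else m u x - r x u) = ∑ x ∈ A, (g u x - g x u) :=
          Finset.sum_congr rfl fun x hx => by simp only [hx, if_true]
        have e2 : ∑ x ∈ W \ A, ((if x ∈ A then g u x else r x u) -
            if x ∈ A then g x u else m u x - r x u) = ∑ x ∈ W \ A, (2 * r x u - m u x) :=
          Finset.sum_congr rfl fun x hx => by
            simp only [(Finset.mem_sdiff.1 hx).2, if_false]; ring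
        rw [e1, e2, ← sub_sub]
        exact this
      · have hu' := hmem u hu h1
        have := o2 u (Finset.mem_insert_of_mem hu')
        rw [contractFun, fiber_of_ne A (ne_of_mem_sdiff ha hu'), Finset.sum_singleton,
          Finset.sum_insert hanot] at this
        simp only [h1, if_false]
        have e1 : ∑ x ∈ A, ((if x ∈ A then m x u - r u x else o u x) -
            if x ∈ A then r u x else o x u) = o u a - o a u := by
          rw [Finset.sum_congr rfl fun x hx => (by simp only [hx, if_true] :
            _ = m x u - r u x - r u x), Finset.sum_sub_distrib, Finset.sum_sub_distrib,
            (hr u hu').2, ← hma u hu', ← o1 a haW u (Finset.mem_insert_of_mem hu')]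
          ring
        have e2 : ∑ x ∈ W \ A, ((if x ∈ A then m x u - r u x else o u x) -
            if x ∈ A then r u x else o x u) = ∑ x ∈ W \ A, (o u x - o x u) :=
          Finset.sum_congr rfl fun x hx => by simp only [(Finset.mem_sdiff.1 hx).2, if_false]
        rw [e1, e2, add_comm]
        exact this

/-- The complement of `A` is absorbed into the root: edges leaving `A`, already oriented, become
root arcs. Cut weights of subsets of `A` do not change, and tightness of `A` is exactly the degree
bound for the new root. -/
theorem Admissible.restrict {W A : Finset α} {m : α → α → ℤ} {p q b : α → ℤ}
    (h : Admissible W m p q b) (hA : A ⊆ W) (r : α → α → ℤ)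
    (hr : ∀ x ∈ A, ∀ v ∈ W \ A, 0 ≤ r x v ∧ r x v ≤ m x v)
    (hsum : 6 ∣ ∑ x ∈ A, ((b - q + p) x - ∑ v ∈ W \ A, (2 * r x v - m x v)))
    (htight : cutWeight W m (p + q) A ≤ 4 + norm6 (∑ x ∈ A, b x)) :
    Admissible A m (fun x => p x + ∑ v ∈ W \ A, (m x v - r x v))
      (fun x => q x + ∑ v ∈ W \ A, r x v) b := by
  have hcut : ∀ B ⊆ A, cutWeight A m ((fun x => p x + ∑ v ∈ W \ A, (m x v - r x v)) +
      (fun x => q x + ∑ v ∈ W \ A, r x v)) B = cutWeight W m (p + q) B := by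
    intro B hB
    unfold cutWeight
    rw [← Finset.sum_add_distrib, ← Finset.sum_add_distrib]
    refine Finset.sum_congr rfl fun x _ => ?_
    have : W \ B = (A \ B) ∪ (W \ A) := by
      ext y; simp only [Finset.mem_sdiff, Finset.mem_union]
      have := @hA y; have := @hB y; tauto
    rw [this, Finset.sum_union (Finset.disjoint_left.2 fun y h1 h2 =>
      (Finset.mem_sdiff.1 h2).2 (Finset.mem_sdiff.1 h1).1)]
    simp only [Pi.add_apply, Finset.sum_sub_distrib]
    ring
  have hroot := htight
  unfold cutWeight at hroot
  simp only [Pi.add_apply, Pi.sub_apply, Finset.sum_add_distrib, Finset.sum_sub_distrib,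
    ← Finset.mul_sum] at hsum hroot
  refine ⟨⟨h.symm, h.diag, h.nonneg, fun x hx => add_nonneg (h.p_nonneg x (hA hx))
    (Finset.sum_nonneg fun v hv => sub_nonneg.2 (hr x hx v hv).2),
    fun x hx => add_nonneg (h.q_nonneg x (hA hx))
    (Finset.sum_nonneg fun v hv => (hr x hx v hv).1), ?_, ?_, fun B hB => ?_⟩,
    fun B hB hne hBA => ?_⟩
  · simp only [Finset.sum_add_distrib, Finset.sum_sub_distrib]
    omega
  · simp only [Finset.sum_add_distrib, Finset.sum_sub_distrib]
    unfold norm6 at *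
    omega
  · rw [hcut B hB]; exact h.parity B (hB.trans hA)
  · rw [hcut B hB]
    exact h.cut B (hB.trans hA) hne fun e => hBA (Finset.Subset.antisymm hB (e ▸ hA))

end Contraction

theorem norm6_neg (b : ℤ) : norm6 (-b) = norm6 b := by unfold norm6; omega

/-! ### Reductions that decrease the number of vertices. -/

section Reductions

variable {α : Type*} [DecidableEq α]

theorem sum_add_single (A : Finset α) (f : α → ℤ) (x : α) (t : ℤ) :
    ∑ u ∈ A, (f + Pi.single x t : α → ℤ) u = ∑ u ∈ A, f u + if x ∈ A then t else 0 := by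
  simp only [Pi.add_apply, Finset.sum_add_distrib, sum_single]

theorem sum_sub_single (A : Finset α) (f : α → ℤ) (x : α) (t : ℤ) :
    ∑ u ∈ A, (f - Pi.single x t : α → ℤ) u = ∑ u ∈ A, f u - if x ∈ A then t else 0 := by
  simp only [Pi.sub_apply, Finset.sum_sub_distrib, sum_single]

theorem cutWeight_singleton {W : Finset α} {m : α → α → ℤ} (s : α → ℤ) (x : α) :
    cutWeight W m s {x} = ∑ y ∈ W \ {x}, m x y + s x := by
  simp [cutWeight]

theorem cutWeight_sdiff {W A : Finset α} {m : α → α → ℤ} (hm : ∀ x y, m x y = m y x)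
    (hA : A ⊆ W) (s : α → ℤ) :
    cutWeight W m s (W \ A) = cutWeight W m s A + ∑ x ∈ W, s x - 2 * ∑ x ∈ A, s x := by
  unfold cutWeight
  rw [Finset.sdiff_sdiff_eq_self hA, Finset.sum_comm, ← Finset.sum_sdiff hA (f := s)]
  simp only [hm]
  ring

theorem Admissible.neg {W : Finset α} {m : α → α → ℤ} {p q b : α → ℤ}
    (h : Admissible W m p q b) : Admissible W m q p (-b) := by
  have hb : ∀ A : Finset α, ∑ x ∈ A, (-b) x = -∑ x ∈ A, b x := fun A => by simp
  refine ⟨⟨h.symm, h.diag, h.nonneg, h.q_nonneg, h.p_nonneg, ?_, ?_, fun A hA => ?_⟩,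
    fun A hA hne hAW => ?_⟩
  · have := h.sum; rw [hb]; omega
  · have := h.root; rw [← norm6_neg, neg_sub, add_comm]; exact this
  · have := h.parity A hA; rw [hb, add_comm q p]; omega
  · have := h.cut A hA hne hAW; rwa [hb, norm6_neg, add_comm q p]

theorem Orientable.of_neg {α : Type*} {W : Finset α} {m : α → α → ℤ} {p q b : α → ℤ}
    (h : Orientable W m (-b - p + q)) : Orientable W m (b - q + p) := by
  have := h.neg
  rwa [show -(-b - p + q) = b - q + p by ring] at this

/-- By parity the weight of a cut and its lower bound differ by an even number, so a cut that is not
tight has slack 2. -/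
theorem Admissible.cut_lower {W : Finset α} {m : α → α → ℤ} {p q b : α → ℤ}
    (h : Admissible W m p q b) {A : Finset α} (hA : A ⊆ W)
    (ht : ¬ cutWeight W m (p + q) A ≤ 4 + norm6 (∑ x ∈ A, b x)) :
    6 + norm6 (∑ x ∈ A, b x) ≤ cutWeight W m (p + q) A := by
  have := h.parity A hA
  unfold norm6 at *
  omega

/-- Induction on the number of vertices handles a tight cut with at least two vertices on either
side. -/
theorem Admissible.orientable_of_tight {W A : Finset α} {m : α → α → ℤ} {p q b : α → ℤ}
    (h : Admissible W m p q b) (hA : A ⊆ W) (hA2 : 2 ≤ A.card) (hAW : A ≠ W)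
    (ht : cutWeight W m (p + q) A ≤ 4 + norm6 (∑ x ∈ A, b x))
    (ih : ∀ (W' : Finset α) (m' : α → α → ℤ) (p' q' b' : α → ℤ), W'.card < W.card →
      Admissible W' m' p' q' b' → Orientable W' m' (b' - q' + p')) :
    Orientable W m (b - q + p) := by
  obtain ⟨a, ha⟩ : A.Nonempty := Finset.card_pos.1 (by omega)
  have hlt : A.card < W.card := Finset.card_lt_card (Finset.ssubset_iff_subset_ne.2 ⟨hA, hAW⟩)
  have hc : (insert a (W \ A)).card < W.card := by
    have := Finset.card_insert_le a (W \ A)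
    have := Finset.card_sdiff_add_card_eq_card hA
    omega
  have h1 := ih _ _ _ _ _ hc (h.contract hA ha fun B hB hn hB' _ => h.cut B hB hn hB')
  have e : contractFun A a b - contractFun A a q + contractFun A a p =
      contractFun A a (b - q + p) := by
    ext u; simp [contractFun, Finset.sum_add_distrib]
  rw [e] at h1
  obtain ⟨r, hr, hsum, hfin⟩ := h1.of_contract h.symm h.diag h.nonneg hA ha
  refine hfin ((ih _ _ _ _ _ hlt (h.restrict hA r hr hsum ht)).congr fun x _ => ?_)
  simp only [Pi.add_apply, Pi.sub_apply, Finset.sum_sub_distrib, ← Finset.mul_sum]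
  ring_nf
  exact dvd_zero 6

/-- Contracting a pair of adjacent vertices whose joining edges can absorb any boundary that is
left after orienting the contracted graph. -/
theorem PreAdmissible.orientable_of_pair {W : Finset α} {m : α → α → ℤ} {p q b : α → ℤ}
    {x y : α} (h : PreAdmissible W m p q b) (hx : x ∈ W) (hy : y ∈ W) (hxy : x ≠ y)
    (hcut : ∀ B ⊆ W, B.Nonempty → B ≠ W → {x, y} ⊆ B ∨ Disjoint {x, y} B →
      4 + norm6 (∑ x ∈ B, b x) ≤ cutWeight W m (p + q) B)
    (hfit : ∀ S : ℤ, 0 ≤ S → S ≤ ∑ v ∈ W \ {x, y}, m x v → ∃ t, 0 ≤ t ∧ t ≤ m x y ∧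
      6 ∣ b x - q x + p x - 2 * S + ∑ v ∈ W \ {x, y}, m x v - (2 * t - m x y))
    (ih : ∀ (W' : Finset α) (m' : α → α → ℤ) (p' q' b' : α → ℤ), W'.card < W.card →
      Admissible W' m' p' q' b' → Orientable W' m' (b' - q' + p')) :
    Orientable W m (b - q + p) := by
  have hA : {x, y} ⊆ W := by simp [Finset.insert_subset_iff, hx, hy]
  have ha : x ∈ ({x, y} : Finset α) := by simp
  have hc : (insert x (W \ {x, y})).card < W.card := by
    have := Finset.card_insert_le x (W \ {x, y})
    have := Finset.card_sdiff_add_card_eq_card hA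
    rw [Finset.card_pair hxy] at this
    omega
  have h1 := ih _ _ _ _ _ hc (h.contract hA ha hcut)
  have e : contractFun {x, y} x b - contractFun {x, y} x q + contractFun {x, y} x p =
      contractFun {x, y} x (b - q + p) := by
    ext u; simp [contractFun, Finset.sum_add_distrib]
  rw [e] at h1
  obtain ⟨r, hr, hsum, hfin⟩ := h1.of_contract h.symm h.diag h.nonneg hA ha
  apply hfin
  obtain ⟨t, ht0, htm, ht⟩ := hfit (∑ v ∈ W \ {x, y}, r x v)
    (Finset.sum_nonneg fun v hv => (hr x ha v hv).1)
    (Finset.sum_le_sum fun v hv => (hr x ha v hv).2)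
  rw [Finset.sum_pair hxy] at hsum
  refine orientable_pair hxy (h.symm x y) (h.diag x) (h.diag y) ht0 htm ?_ hsum
  simp only [Pi.add_apply, Pi.sub_apply, Finset.sum_sub_distrib, ← Finset.mul_sum]
  convert ht using 1
  ring

theorem sum_sdiff_pair {W : Finset α} {x y : α} (hy : y ∈ W) (hxy : x ≠ y) (f : α → ℤ) :
    ∑ v ∈ W \ {x}, f v = f y + ∑ v ∈ W \ {x, y}, f v := by
  have : W \ {x} = insert y (W \ {x, y}) := by
    ext z; simp only [Finset.mem_sdiff, Finset.mem_insert, Finset.mem_singleton]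
    by_cases h : z = y
    · subst h; simp [hy, hxy.symm]
    · simp [h]
  rw [this, Finset.sum_insert (by simp)]

/-- Reversing a parallel edge changes the net out-degree by 2. With two such edges all three
residues modulo 6 of the right parity occur, so any boundary left over from the contraction can be
absorbed. -/
theorem Admissible.orientable_of_parallel {W : Finset α} {m : α → α → ℤ} {p q b : α → ℤ}
    {x y : α} (h : Admissible W m p q b) (hx : x ∈ W) (hy : y ∈ W) (hxy : x ≠ y)
    (hm : 2 ≤ m x y)
    (ih : ∀ (W' : Finset α) (m' : α → α → ℤ) (p' q' b' : α → ℤ), W'.card < W.card →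
      Admissible W' m' p' q' b' → Orientable W' m' (b' - q' + p')) :
    Orientable W m (b - q + p) := by
  refine h.toPreAdmissible.orientable_of_pair hx hy hxy (fun B hB hn hB' _ => h.cut B hB hn hB')
    (fun S _ _ => ?_) ih
  have := h.parity {x} (by simpa using hx)
  rw [cutWeight_singleton, sum_sdiff_pair hy hxy, Finset.sum_singleton, Pi.add_apply] at this
  generalize ∑ v ∈ W \ {x, y}, m x v = M at *
  refine ⟨((b x - q x + p x - 2 * S + M + m x y) / 2) % 3, ?_, ?_, ?_⟩ <;> omega

/-- A vertex of degree two with zero boundary is suppressed. -/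
theorem PreAdmissible.orientable_of_degree_two {W : Finset α} {m : α → α → ℤ} {p q b : α → ℤ}
    {v y : α} (h : PreAdmissible W m p q b) (hv : v ∈ W) (hy : y ∈ W) (hvy : v ≠ y)
    (hcut : ∀ B ⊆ W, B.Nonempty → B ≠ W → {v, y} ⊆ B ∨ Disjoint {v, y} B →
      4 + norm6 (∑ x ∈ B, b x) ≤ cutWeight W m (p + q) B)
    (hm : m v y = 1) (hd : cutWeight W m (p + q) {v} = 2) (hb : 6 ∣ b v)
    (ih : ∀ (W' : Finset α) (m' : α → α → ℤ) (p' q' b' : α → ℤ), W'.card < W.card →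
      Admissible W' m' p' q' b' → Orientable W' m' (b' - q' + p')) :
    Orientable W m (b - q + p) := by
  refine h.orientable_of_pair hv hy hvy hcut (fun S h0 h1 => ?_) ih
  rw [cutWeight_singleton, sum_sdiff_pair hy hvy, Pi.add_apply] at hd
  have := h.p_nonneg v hv
  have := h.q_nonneg v hv
  have : 0 ≤ ∑ u ∈ W \ {v, y}, m v u := Finset.sum_nonneg fun u _ => h.nonneg v u
  generalize ∑ v_1 ∈ W \ {v, y}, m v v_1 = M at *
  -- The one other edge or root arc at `v` contributes 1 or -1, and the edge `v y` is directed to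
  -- continue it.
  by_cases h : 6 ∣ b v - q v + p v - 2 * S + M - 1
  · exact ⟨1, by omega, by omega, by omega⟩
  · exact ⟨0, by omega, by omega, by omega⟩

theorem two_le_card_of_mem {α : Type*} {A : Finset α} {x y : α} (hx : x ∈ A) (hy : y ∈ A) (hxy : x ≠ y) :
    2 ≤ A.card := Finset.one_lt_card.2 ⟨x, hx, y, hy, hxy⟩

/-- An arc from the root to `v` followed by `v y` is lifted to an arc from the root to `y`, leaving
`v` with degree 2. A set loses weight, namely 2, only if it contains `v` but not `y`. If it does not
split the pair `v, z` it has two vertices, and `hbig` covers the loss. -/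
theorem Admissible.orientable_of_lift_root {W : Finset α} {m : α → α → ℤ} {p q b : α → ℤ}
    {v y z : α} (h : Admissible W m p q b)
    (hbig : ∀ A ⊆ W, 2 ≤ A.card → A ≠ W →
      6 + norm6 (∑ x ∈ A, b x) ≤ cutWeight W m (p + q) A)
    (hv : v ∈ W) (hy : y ∈ W) (hz : z ∈ W) (hvy : v ≠ y) (hvz : v ≠ z) (hyz : y ≠ z)
    (hmy : m v y = 1) (hmz : m v z = 1) (hp : 1 ≤ p v)
    (hd : cutWeight W m (p + q) {v} = 4) (hb : 6 ∣ b v)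
    (ih : ∀ (W' : Finset α) (m' : α → α → ℤ) (p' q' b' : α → ℤ), W'.card < W.card →
      Admissible W' m' p' q' b' → Orientable W' m' (b' - q' + p')) :
    Orientable W m (b - q + p) := by
  have hcut : ∀ A, cutWeight W (m - link v y) (p - Pi.single v 1 + Pi.single y 1 + q) A =
      cutWeight W m (p + q) A - if v ∈ A ∧ y ∉ A then 2 else 0 := by
    intro A
    unfold cutWeight
    simp only [Pi.add_apply, Pi.sub_apply, Finset.sum_add_distrib, Finset.sum_sub_distrib,
      sum_single, sum_link_cut hv hy]
    by_cases h1 : v ∈ A <;> by_cases h2 : y ∈ A <;> simp only [h1, h2] <;> simp <;> ring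
  have hsum : ∑ x ∈ W, (p - Pi.single v 1 + Pi.single y 1 : α → ℤ) x = ∑ x ∈ W, p x := by
    rw [sum_add_single, sum_sub_single, if_pos hv, if_pos hy]; ring
  have h1 : PreAdmissible W (m - link v y) (p - Pi.single v 1 + Pi.single y 1) q b := by
    refine ⟨fun a c => ?_, fun a => ?_, fun a c => ?_, fun a ha => ?_, h.q_nonneg, ?_, ?_,
      fun A hA => ?_⟩
    · simp only [Pi.sub_apply, h.symm a c, link_symm v y a c]
    · simp only [Pi.sub_apply, h.diag, link_diag hvy, sub_zero]
    · exact sub_nonneg.2 (link_le h.symm h.nonneg hvy hmy.ge a c)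
    · have := h.p_nonneg a ha
      simp only [Pi.add_apply, Pi.sub_apply, Pi.single_apply]
      by_cases hav : a = v
      · subst hav; rw [if_pos rfl, if_neg hvy]; omega
      · rw [if_neg hav]; split_ifs <;> omega
    · rw [hsum]; exact h.sum
    · rw [hsum]; exact h.root
    · rw [hcut]; have := h.parity A hA; split_ifs <;> omega
  have key := h1.orientable_of_degree_two hv hz hvz (fun B hB hn hBW hB' => ?_)
    (by simp only [Pi.sub_apply, link_apply_left hvy, if_neg hyz.symm, hmz, sub_zero])
    (by rw [hcut, hd]; simp [hvy.symm]) hb ih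
  · apply Orientable.add_arc hv hy
    rw [show b - q + p - Pi.single v 1 + Pi.single y 1 =
      b - q + (p - Pi.single v 1 + Pi.single y 1) by ring]
    exact key
  · rw [hcut]
    split_ifs with hvB
    · rcases hB' with hB' | hB'
      · have := hbig B hB (two_le_card_of_mem (hB' (by simp)) (hB' (by simp : z ∈ _)) hvz) hBW
        omega
      · exact absurd hvB.1 (Finset.disjoint_left.1 hB' (by simp))
    · have := h.cut B hB hn hBW; omega

/-- As for lifting at the root, except that sets containing `x` and `y` but not `v` also lose 2.
These too have at least two vertices, so `hbig` applies. -/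
theorem Admissible.orientable_of_lift {W : Finset α} {m : α → α → ℤ} {p q b : α → ℤ}
    {v x y z : α} (h : Admissible W m p q b)
    (hbig : ∀ A ⊆ W, 2 ≤ A.card → A ≠ W →
      6 + norm6 (∑ x ∈ A, b x) ≤ cutWeight W m (p + q) A)
    (hv : v ∈ W) (hx : x ∈ W) (hy : y ∈ W) (hz : z ∈ W) (hvx : v ≠ x) (hvy : v ≠ y) (hvz : v ≠ z)
    (hxy : x ≠ y) (hxz : x ≠ z) (hyz : y ≠ z)
    (hmx : m v x = 1) (hmy : m v y = 1) (hmz : m v z = 1)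
    (hd : cutWeight W m (p + q) {v} = 4) (hb : 6 ∣ b v)
    (ih : ∀ (W' : Finset α) (m' : α → α → ℤ) (p' q' b' : α → ℤ), W'.card < W.card →
      Admissible W' m' p' q' b' → Orientable W' m' (b' - q' + p')) :
    Orientable W m (b - q + p) := by
  have hcut : ∀ A, cutWeight W (m - link x v - link v y + link x y) (p + q) A =
      cutWeight W m (p + q) A - (if v ∈ A ∧ x ∉ A ∧ y ∉ A then 2 else 0) -
        if v ∉ A ∧ x ∈ A ∧ y ∈ A then 2 else 0 := by
    intro A
    unfold cutWeight
    simp only [Pi.add_apply, Pi.sub_apply, Finset.sum_add_distrib, Finset.sum_sub_distrib,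
      sum_link_cut hx hv, sum_link_cut hv hy, sum_link_cut hx hy]
    by_cases h1 : v ∈ A <;> by_cases h2 : y ∈ A <;> by_cases h3 : x ∈ A <;>
      simp only [h1, h2, h3] <;> simp <;> ring
  have h1 : PreAdmissible W (m - link x v - link v y + link x y) p q b := by
    refine ⟨fun a c => ?_, fun a => ?_, fun a c => ?_, h.p_nonneg, h.q_nonneg, h.sum, h.root,
      fun A hA => ?_⟩
    · simp only [Pi.sub_apply, Pi.add_apply, h.symm a c, link_symm _ _ a c]
    · simp only [Pi.sub_apply, Pi.add_apply, h.diag, link_diag hvy, link_diag hvx.symm,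
        link_diag hxy, sub_zero, add_zero]
    · have h1 : 0 ≤ (m - link x v) a c :=
        sub_nonneg.2 (link_le h.symm h.nonneg hvx.symm (by rw [h.symm, hmx]) a c)
      have h2 : 0 ≤ (m - link x v - link v y) a c := by
        refine sub_nonneg.2 (link_le (fun a c => ?_) (fun a c => ?_) hvy ?_ a c)
        · simp only [Pi.sub_apply, h.symm a c, link_symm x v a c]
        · exact sub_nonneg.2 (link_le h.symm h.nonneg hvx.symm (by rw [h.symm, hmx]) a c)
        · have : link x v v y = 0 := by unfold link arc; simp [hvx, hxy.symm]
          rw [Pi.sub_apply, Pi.sub_apply, this, hmy]; norm_num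
      exact add_nonneg h2 (link_nonneg ..)
    · rw [hcut]; have := h.parity A hA; split_ifs <;> omega
  have key := h1.orientable_of_degree_two hv hz hvz (fun B hB hn hBW hB' => ?_)
    (by
      have e1 : link x v v z = 0 := by unfold link arc; simp [hvx, hxz.symm]
      have e2 : link x y v z = 0 := by unfold link arc; simp [hvx, hvy]
      simp only [Pi.sub_apply, Pi.add_apply, link_apply_left hvy, if_neg hyz.symm, hmz, e1, e2]
      norm_num)
    (by rw [hcut, hd]; simp [hvy.symm, hvx.symm]) hb ih
  · exact Orientable.of_lift h.nonneg hx hy hv hxy hvx hvy key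
  · rw [hcut]
    have := h.cut B hB hn hBW
    by_cases hvB : v ∈ B
    · rw [if_neg (fun e : v ∉ B ∧ _ => e.1 hvB)]
      rcases hB' with hB' | hB'
      · have := hbig B hB (two_le_card_of_mem (hB' (by simp)) (hB' (by simp : z ∈ _)) hvz) hBW
        split_ifs <;> omega
      · exact absurd hvB (Finset.disjoint_left.1 hB' (by simp))
    · rw [if_neg (fun e : v ∈ B ∧ _ => hvB e.1)]
      by_cases hxyB : x ∈ B ∧ y ∈ B
      · have := hbig B hB (two_le_card_of_mem hxyB.1 hxyB.2 hxy) hBW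
        split_ifs <;> omega
      · simp only [hvB, hxyB]; simp; omega

/-- A vertex of degree four with zero boundary is split off. -/
theorem Admissible.orientable_of_degree_four {W : Finset α} {m : α → α → ℤ} {p q b : α → ℤ}
    {v : α} (h : Admissible W m p q b) (hW : 3 ≤ W.card)
    (hbig : ∀ A ⊆ W, 2 ≤ A.card → A ≠ W →
      6 + norm6 (∑ x ∈ A, b x) ≤ cutWeight W m (p + q) A)
    (hsimple : ∀ x ∈ W, ∀ y ∈ W, m x y ≤ 1) (hv : v ∈ W)
    (hd : cutWeight W m (p + q) {v} = 4)
    (ih : ∀ (W' : Finset α) (m' : α → α → ℤ) (p' q' b' : α → ℤ), W'.card < W.card →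
      Admissible W' m' p' q' b' → Orientable W' m' (b' - q' + p')) :
    Orientable W m (b - q + p) := by
  have hvW : {v} ⊆ W := by simpa using hv
  have hvne : ({v} : Finset α) ≠ W := fun e => by rw [← e] at hW; simp at hW
  have hb : 6 ∣ b v := by
    have := h.cut {v} hvW (by simp) hvne
    rw [hd, Finset.sum_singleton] at this
    unfold norm6 at this; omega
  have hp := h.p_nonneg v hv
  have hq := h.q_nonneg v hv
  -- The root has degree at most 7. If three of its arcs met `v`, the set `W \ {v}` would have
  -- weight at most 4 + 7 - 6 = 5, against the bound 6.
  have hpq : p v + q v ≤ 2 := by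
    have h1 := hbig (W \ {v}) Finset.sdiff_subset
      (by rw [Finset.card_sdiff_of_subset hvW]; simp; omega)
      (fun e => by simp [hv] at e)
    rw [cutWeight_sdiff h.symm hvW, hd] at h1
    have h2 := h.root
    simp only [Pi.add_apply, Finset.sum_add_distrib, Finset.sum_singleton] at h1
    unfold norm6 at h1 h2; omega
  set N := (W \ {v}).filter fun u => m v u = 1
  have hN : ∀ u ∈ N, u ∈ W ∧ v ≠ u ∧ m v u = 1 := by
    intro u hu
    simp only [N, Finset.mem_filter, Finset.mem_sdiff, Finset.mem_singleton] at hu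
    exact ⟨hu.1.1, fun e => hu.1.2 e.symm, hu.2⟩
  have hcard : (N.card : ℤ) + (p v + q v) = 4 := by
    rw [cutWeight_singleton, Pi.add_apply] at hd
    rw [← hd, Finset.card_filter, Nat.cast_sum]
    congr 1
    refine Finset.sum_congr rfl fun u hu => ?_
    have := hsimple v hv u (Finset.mem_sdiff.1 hu).1
    have := h.nonneg v u
    split_ifs <;> push_cast <;> omega
  rcases (by omega : p v + q v = 0 ∨ 1 ≤ p v ∨ 1 ≤ q v) with h0 | h1 | h1
  · obtain ⟨x, hx, y, hy, z, hz, hxy, hxz, hyz⟩ := Finset.two_lt_card.1 (by omega : 2 < N.card)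
    obtain ⟨x1, x2, x3⟩ := hN x hx
    obtain ⟨y1, y2, y3⟩ := hN y hy
    obtain ⟨z1, z2, z3⟩ := hN z hz
    exact h.orientable_of_lift hbig hv x1 y1 z1 x2 y2 z2 hxy hxz hyz x3 y3 z3 hd hb ih
  · obtain ⟨y, hy, z, hz, hyz⟩ := Finset.one_lt_card.1 (by omega : 1 < N.card)
    obtain ⟨y1, y2, y3⟩ := hN y hy
    obtain ⟨z1, z2, z3⟩ := hN z hz
    exact h.orientable_of_lift_root hbig hv y1 z1 y2 z2 hyz y3 z3 h1 hd hb ih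
  · obtain ⟨y, hy, z, hz, hyz⟩ := Finset.one_lt_card.1 (by omega : 1 < N.card)
    obtain ⟨y1, y2, y3⟩ := hN y hy
    obtain ⟨z1, z2, z3⟩ := hN z hz
    refine Orientable.of_neg (h.neg.orientable_of_lift_root (fun A hA hc hAW => ?_) hv y1 z1 y2 z2
      hyz y3 z3 h1 (by rwa [add_comm]) (by simpa using hb) ih)
    have := hbig A hA hc hAW
    rw [add_comm q p]
    simpa [norm6_neg] using this

end Reductions

/-! ### Deleting edges, and the induction proving the orientation theorem. -/

section Induction

variable {α : Type*} [DecidableEq α]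

/-- The arc from `y` to `x` is deleted; the boundary at `x` may first be shifted by `3`, either
adding three arcs from the root to `x`, or replacing one such arc by two arcs from `x`. -/
theorem Admissible.delete {W : Finset α} {m : α → α → ℤ} {p q b : α → ℤ} {x y : α} {s t c : ℤ}
    (h : Admissible W m p q b)
    (hbig : ∀ A ⊆ W, 2 ≤ A.card → A ≠ W →
      6 + norm6 (∑ x ∈ A, b x) ≤ cutWeight W m (p + q) A)
    (hx : x ∈ W) (hy : y ∈ W) (hxy : x ≠ y) (hm : 1 ≤ m x y)
    (hst : s = 0 ∧ t = 0 ∧ c = 0 ∨ s = 3 ∧ t = 0 ∧ c = 3 ∨ s = -1 ∧ t = 2 ∧ c = 3)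
    (hp : 0 ≤ p x + s)
    (hroot : ∑ x ∈ W, p x + ∑ x ∈ W, q x + s + t ≤
      4 + norm6 (∑ x ∈ W, p x - ∑ x ∈ W, q x + s - t))
    (hcx : 4 + norm6 (b x + 1 + c) ≤ cutWeight W m (p + q) {x} + s + t - 1)
    (hcy : 4 + norm6 (b y - 1) ≤ cutWeight W m (p + q) {y} - 1) :
    Admissible W (m - link x y) (p + Pi.single x s) (q + Pi.single x t)
      (b + Pi.single x (1 + c) - Pi.single y 1) := by
  have hcut : ∀ A, cutWeight W (m - link x y) (p + Pi.single x s + (q + Pi.single x t)) A =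
      cutWeight W m (p + q) A + (if x ∈ A then s + t else 0) -
        ((if x ∈ A ∧ y ∉ A then 1 else 0) + if y ∈ A ∧ x ∉ A then 1 else 0) := by
    intro A
    unfold cutWeight
    simp only [Pi.add_apply, Pi.sub_apply, Finset.sum_add_distrib, Finset.sum_sub_distrib,
      sum_single, sum_link_cut hx hy]
    split_ifs <;> ring
  have hsum : ∀ A : Finset α, ∑ u ∈ A, (b + Pi.single x (1 + c) - Pi.single y 1 : α → ℤ) u =
      ∑ u ∈ A, b u + (if x ∈ A then 1 + c else 0) - if y ∈ A then 1 else 0 := fun A => by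
    rw [sum_sub_single, sum_add_single]
  refine ⟨⟨fun u v => ?_, fun u => ?_, fun u v => ?_, fun u hu => ?_, fun u hu => ?_, ?_, ?_,
    fun A hA => ?_⟩, fun A hA hne hAW => ?_⟩
  · simp only [Pi.sub_apply, h.symm u v, link_symm _ _ u v]
  · simp only [Pi.sub_apply, h.diag, link_diag hxy, sub_zero]
  · exact sub_nonneg.2 (link_le h.symm h.nonneg hxy hm u v)
  · have := h.p_nonneg u hu
    simp only [Pi.add_apply, Pi.single_apply]
    split_ifs with e
    · subst e; exact hp
    · omega
  · have := h.q_nonneg u hu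
    simp only [Pi.add_apply, Pi.single_apply]
    split_ifs <;> omega
  · have := h.sum
    rw [hsum, sum_add_single, sum_add_single, if_pos hx, if_pos hy, if_pos hx, if_pos hx]
    omega
  · rw [sum_add_single, sum_add_single, if_pos hx, if_pos hx]
    convert hroot using 1
    · ring
    · congr 2; ring
  · have := h.parity A hA
    rw [hcut, hsum]
    by_cases h1 : x ∈ A <;> by_cases h2 : y ∈ A <;> simp only [h1, h2] <;> simp <;> omega
  · rw [hcut, hsum]
    by_cases hA2 : 2 ≤ A.card
    · have := hbig A hA hA2 hAW
      unfold norm6 at this ⊢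
      by_cases h1 : x ∈ A <;> by_cases h2 : y ∈ A <;> simp only [h1, h2] <;> simp <;> omega
    · obtain ⟨z, rfl⟩ := Finset.card_eq_one.1
        (by have := Finset.card_pos.2 hne; omega : A.card = 1)
      rw [Finset.sum_singleton]
      simp only [Finset.mem_singleton]
      by_cases h1 : x = z
      · subst h1; simp only [hxy.symm]; simp
        rw [show b x + (1 + c) = b x + 1 + c by ring]; omega
      · by_cases h2 : y = z
        · subst h2; simp only [hxy]; simp; omega
        · have := h.cut {z} hA hne hAW
          rw [Finset.sum_singleton] at this
          simp only [h1, h2]; simpa using this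

/-- The size of an instance with a given number of vertices, for the induction. -/
def edgeSize (W : Finset α) (m : α → α → ℤ) (p q : α → ℤ) : ℤ :=
  2 * ∑ x ∈ W, ∑ y ∈ W, m x y + (∑ x ∈ W, p x + ∑ x ∈ W, q x)

theorem Admissible.orientable_of_delete {W : Finset α} {m : α → α → ℤ} {p q b : α → ℤ} {x y : α}
    {s t c : ℤ} (h : Admissible W m p q b)
    (hbig : ∀ A ⊆ W, 2 ≤ A.card → A ≠ W →
      6 + norm6 (∑ x ∈ A, b x) ≤ cutWeight W m (p + q) A)
    (hx : x ∈ W) (hy : y ∈ W) (hxy : x ≠ y) (hm : 1 ≤ m x y)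
    (hst : s = 0 ∧ t = 0 ∧ c = 0 ∨ s = 3 ∧ t = 0 ∧ c = 3 ∨ s = -1 ∧ t = 2 ∧ c = 3)
    (hp : 0 ≤ p x + s)
    (hroot : ∑ x ∈ W, p x + ∑ x ∈ W, q x + s + t ≤
      4 + norm6 (∑ x ∈ W, p x - ∑ x ∈ W, q x + s - t))
    (hcx : 4 + norm6 (b x + 1 + c) ≤ cutWeight W m (p + q) {x} + s + t - 1)
    (hcy : 4 + norm6 (b y - 1) ≤ cutWeight W m (p + q) {y} - 1)
    (ih : ∀ m' p' q' b', edgeSize W m' p' q' < edgeSize W m p q →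
      Admissible W m' p' q' b' → Orientable W m' (b' - q' + p')) :
    Orientable W m (b - q + p) := by
  have h1 := ih _ _ _ _ ?_ (h.delete hbig hx hy hxy hm hst hp hroot hcx hcy)
  · apply Orientable.add_arc hy hx
    have e : link y x = link x y := by ext u v; simp only [link]; ring
    rw [e]
    refine h1.congr fun u _ => ?_
    simp only [Pi.add_apply, Pi.sub_apply, Pi.single_apply]
    split_ifs <;> omega
  -- An edge weighs 4 in `edgeSize`, being counted from both ends and doubled. This exceeds the at
  -- most three root arcs gained.
  · unfold edgeSize
    rw [sum_add_single, sum_add_single, if_pos hx, if_pos hx]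
    simp only [Pi.sub_apply, Finset.sum_sub_distrib, link, Finset.sum_add_distrib, sum_arc, hx, hy]
    simp
    omega

/-- The case where every vertex needs more outgoing than incoming arcs. -/
theorem Admissible.orientable_of_positive {W : Finset α} {m : α → α → ℤ} {p q b : α → ℤ}
    (h : Admissible W m p q b) (hne : W.Nonempty)
    (hbig : ∀ A ⊆ W, 2 ≤ A.card → A ≠ W →
      6 + norm6 (∑ x ∈ A, b x) ≤ cutWeight W m (p + q) A)
    (hpos : ∀ x ∈ W, cutWeight W m (p + q) {x} = 4 + b x % 6 ∧ (b x % 6 = 1 ∨ b x % 6 = 2))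
    (hnbr : ∀ x ∈ W, ∃ y ∈ W, x ≠ y ∧ 1 ≤ m x y)
    (ih : ∀ m' p' q' b', edgeSize W m' p' q' < edgeSize W m p q →
      Admissible W m' p' q' b' → Orientable W m' (b' - q' + p')) :
    Orientable W m (b - q + p) := by
  have hroot := h.root
  -- An arc from `v` to the root can simply be deleted: the tight vertex `v` loses 1 both in degree
  -- and in boundary.
  by_cases hq : ∃ v ∈ W, 1 ≤ q v
  · obtain ⟨v, hv, hqv⟩ := hq
    have hcut : ∀ A, cutWeight W m (p + (q - Pi.single v 1)) A =
        cutWeight W m (p + q) A - if v ∈ A then 1 else 0 := by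
      intro A
      unfold cutWeight
      simp only [Pi.add_apply, Pi.sub_apply, Finset.sum_add_distrib, Finset.sum_sub_distrib,
        sum_single]
      ring
    have h1 : Admissible W m p (q - Pi.single v 1) (b - Pi.single v 1) := by
      refine ⟨⟨h.symm, h.diag, h.nonneg, h.p_nonneg, fun u hu => ?_, ?_, ?_, fun A hA => ?_⟩,
        fun A hA hne hAW => ?_⟩
      · have := h.q_nonneg u hu
        simp only [Pi.sub_apply, Pi.single_apply]
        split_ifs with e
        · subst e; omega
        · omega
      · have := h.sum
        rw [sum_sub_single, sum_sub_single, if_pos hv]; omega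
      · rw [sum_sub_single, if_pos hv]; unfold norm6 at hroot ⊢; omega
      · have := h.parity A hA
        rw [hcut, sum_sub_single]; omega
      · rw [hcut, sum_sub_single]
        split_ifs with hvA
        · by_cases hA2 : 2 ≤ A.card
          · have := hbig A hA hA2 hAW
            unfold norm6 at this ⊢; omega
          · obtain ⟨z, rfl⟩ := Finset.card_eq_one.1
              (by have := Finset.card_pos.2 hne; omega : A.card = 1)
            obtain rfl : v = z := by simpa using hvA
            have := hpos v hv
            rw [Finset.sum_singleton]; unfold norm6; omega
        · rw [sub_zero, sub_zero]; exact h.cut A hA hne hAW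
    have := ih _ _ _ _ (by unfold edgeSize; rw [sum_sub_single, if_pos hv]; omega) h1
    rwa [sub_sub_sub_cancel_right] at this
  · have hq0 : ∑ x ∈ W, q x = 0 := Finset.sum_eq_zero fun x hx => by
      have := h.q_nonneg x hx
      by_contra hne
      exact hq ⟨x, hx, by omega⟩
    have hp0 := Finset.sum_nonneg h.p_nonneg
    rw [hq0] at hroot
    -- All root arcs now leave the root. An edge at `x` is deleted while the boundary of `x` is
    -- shifted by 3. This uses an existing root arc if there is one, and three new arcs if the root
    -- is isolated.
    by_cases hp : ∃ x ∈ W, 1 ≤ p x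
    · obtain ⟨x, hx, hpx⟩ := hp
      obtain ⟨y, hy, hxy, hm⟩ := hnbr x hx
      have h1 := hpos x hx
      have h2 := hpos y hy
      have h3 := Finset.single_le_sum h.p_nonneg hx
      refine h.orientable_of_delete hbig hx hy hxy hm (s := -1) (t := 2) (c := 3) (by simp)
        (by omega) ?_ ?_ ?_ ih
      · rw [hq0]; unfold norm6 at hroot ⊢; omega
      · unfold norm6; omega
      · unfold norm6; omega
    · obtain ⟨x, hx⟩ := hne
      obtain ⟨y, hy, hxy, hm⟩ := hnbr x hx
      have h1 := hpos x hx
      have h2 := hpos y hy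
      have h3 : ∑ x ∈ W, p x = 0 := Finset.sum_eq_zero fun x hx => by
        have := h.p_nonneg x hx
        by_contra hne
        exact hp ⟨x, hx, by omega⟩
      have := h.p_nonneg x hx
      refine h.orientable_of_delete hbig hx hy hxy hm (s := 3) (t := 0) (c := 3) (by simp)
        (by omega) ?_ ?_ ?_ ih
      · rw [hq0, h3]; unfold norm6; omega
      · unfold norm6; omega
      · unfold norm6; omega

/-- Otherwise `x` sends at least 4 edges, all to the root. The root has degree at most 7, so at most
3 edges leave `W \ {x}`, where at least 6 are required. -/
theorem Admissible.exists_neighbor {W : Finset α} {m : α → α → ℤ} {p q b : α → ℤ}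
    (h : Admissible W m p q b) (hW : 3 ≤ W.card)
    (hbig : ∀ A ⊆ W, 2 ≤ A.card → A ≠ W →
      6 + norm6 (∑ x ∈ A, b x) ≤ cutWeight W m (p + q) A) {x : α} (hx : x ∈ W) :
    ∃ y ∈ W, x ≠ y ∧ 1 ≤ m x y := by
  by_contra! hno
  have hxW : {x} ⊆ W := by simpa using hx
  have h0 : ∑ y ∈ W \ {x}, m x y = 0 := Finset.sum_eq_zero fun y hy => by
    have := h.nonneg x y
    simp only [Finset.mem_sdiff, Finset.mem_singleton] at hy
    have := hno y hy.1 (fun e => hy.2 e.symm)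
    omega
  have h1 := hbig (W \ {x}) Finset.sdiff_subset
    (by rw [Finset.card_sdiff_of_subset hxW]; simp; omega)
    (fun e => by simp [hx] at e)
  have h2 := h.cut {x} hxW (by simp) (fun e => by rw [← e] at hW; simp at hW)
  have h3 := h.root
  rw [cutWeight_sdiff h.symm hxW] at h1
  rw [cutWeight_singleton, h0] at h1 h2
  simp only [Pi.add_apply, Finset.sum_add_distrib, Finset.sum_singleton] at h1 h2
  unfold norm6 at h1 h2 h3; omega

/-- Deleting the root does not disconnect the graph: some edge joins `P` to its complement. -/
theorem Admissible.exists_edge_between {W P : Finset α} {m : α → α → ℤ} {p q b : α → ℤ}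
    (h : Admissible W m p q b) (hP : P ⊆ W) (hne : P.Nonempty) (hPW : P ≠ W) :
    ∃ x ∈ P, ∃ y ∈ W \ P, 1 ≤ m x y := by
  by_contra! hno
  have h0 : ∑ x ∈ P, ∑ y ∈ W \ P, m x y = 0 := Finset.sum_eq_zero fun x hx =>
    Finset.sum_eq_zero fun y hy => by
      have := hno x hx y hy
      have := h.nonneg x y
      omega
  have h1 := h.cut P hP hne hPW
  have h2 := h.cut (W \ P) Finset.sdiff_subset (by
    rw [Finset.sdiff_nonempty]; exact fun e => hPW (Finset.Subset.antisymm hP e)) (fun e => by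
    rw [Finset.sdiff_eq_self_iff_disjoint] at e
    obtain ⟨x, hx⟩ := hne
    exact Finset.disjoint_left.1 e (hP hx) hx)
  -- Both parts would need at least 4 root arcs, but the root has degree at most 7.
  have h3 := h.root
  rw [cutWeight_sdiff h.symm hP] at h2
  rw [cutWeight, h0] at h1 h2
  simp only [Pi.add_apply, Finset.sum_add_distrib] at h1 h2
  unfold norm6 at h1 h2 h3; omega

/-- Adding the two vertex conditions and subtracting the root bound shows, by the triangle
inequality for `norm6`, that the two vertices are joined by at least two edges. -/
theorem Admissible.orientable_of_card_two {W : Finset α} {m : α → α → ℤ} {p q b : α → ℤ}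
    (h : Admissible W m p q b) (hW : W.card = 2)
    (ih : ∀ (W' : Finset α) (m' : α → α → ℤ) (p' q' b' : α → ℤ), W'.card < W.card →
      Admissible W' m' p' q' b' → Orientable W' m' (b' - q' + p')) :
    Orientable W m (b - q + p) := by
  obtain ⟨x, y, hxy, rfl⟩ := Finset.card_eq_two.1 hW
  refine h.orientable_of_parallel (by simp) (by simp) hxy ?_ ih
  have e1 : ({x, y} : Finset α) \ {x} = {y} := by
    ext z; simp only [Finset.mem_sdiff, Finset.mem_insert, Finset.mem_singleton]
    constructor
    · tauto
    · rintro rfl; exact ⟨Or.inr rfl, hxy.symm⟩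
  have e2 : ({x, y} : Finset α) \ {y} = {x} := by
    ext z; simp only [Finset.mem_sdiff, Finset.mem_insert, Finset.mem_singleton]
    constructor
    · tauto
    · rintro rfl; exact ⟨Or.inl rfl, hxy⟩
  have h1 := h.cut {x} (by simp) (by simp) (fun e => by rw [← e] at hW; simp at hW)
  have h2 := h.cut {y} (by simp) (by simp) (fun e => by rw [← e] at hW; simp at hW)
  have h3 := h.root
  have h4 := h.sum
  rw [cutWeight_singleton, e1] at h1
  rw [cutWeight_singleton, e2] at h2
  simp only [Finset.sum_singleton, Pi.add_apply, Finset.sum_pair hxy] at h1 h2 h3 h4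
  have := h.symm x y
  unfold norm6 at h1 h2 h3
  omega

/-- The modulo `3` orientation theorem of Lovász, Thomassen, Wu and Zhang. -/
theorem Admissible.orientable {W : Finset α} {m : α → α → ℤ} {p q b : α → ℤ}
    (h : Admissible W m p q b) : Orientable W m (b - q + p) := by
  induction hn : W.card using Nat.strong_induction_on generalizing W m p q b with
  | _ n ihn =>
  induction hk : (edgeSize W m p q).toNat using Nat.strong_induction_on generalizing m p q b with
  | _ k ihk =>
  subst hn hk
  have ih1 : ∀ (W' : Finset α) (m' : α → α → ℤ) (p' q' b' : α → ℤ), W'.card < W.card →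
      Admissible W' m' p' q' b' → Orientable W' m' (b' - q' + p') :=
    fun W' m' p' q' b' hc h' => ihn _ hc h' rfl
  have ih2 : ∀ m' p' q' b', edgeSize W m' p' q' < edgeSize W m p q →
      Admissible W m' p' q' b' → Orientable W m' (b' - q' + p') := by
    intro m' p' q' b' hlt h'
    refine ihk _ ?_ h' rfl
    have : 0 ≤ edgeSize W m' p' q' := by
      unfold edgeSize
      have := Finset.sum_nonneg h'.p_nonneg
      have := Finset.sum_nonneg h'.q_nonneg
      have := Finset.sum_nonneg fun x (_ : x ∈ W) => Finset.sum_nonneg fun y (_ : y ∈ W) =>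
        h'.nonneg x y
      omega
    omega
  clear ihn ihk
  rcases (by omega : W.card = 0 ∨ W.card = 1 ∨ W.card = 2 ∨ 3 ≤ W.card) with hW | hW | hW | hW
  · rw [Finset.card_eq_zero] at hW
    subst hW
    exact ⟨0, by simp, by simp, by simp⟩
  · obtain ⟨x, rfl⟩ := Finset.card_eq_one.1 hW
    have := h.sum
    refine ⟨0, by simp, by simp [h.diag], ?_⟩
    simp only [Finset.sum_singleton] at this
    simp
    omega
  · exact h.orientable_of_card_two hW ih1
  by_contra hcon
  have hbig : ∀ A ⊆ W, 2 ≤ A.card → A ≠ W →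
      6 + norm6 (∑ x ∈ A, b x) ≤ cutWeight W m (p + q) A := fun A hA hA2 hAW =>
    h.cut_lower hA fun ht => hcon (h.orientable_of_tight hA hA2 hAW ht ih1)
  have hsimple : ∀ x ∈ W, ∀ y ∈ W, m x y ≤ 1 := fun x hx y hy => by
    by_contra hm
    have hxy : x ≠ y := fun e => by rw [e, h.diag] at hm; omega
    exact hcon (h.orientable_of_parallel hx hy hxy (by omega) ih1)
  have hfour : ∀ x ∈ W, cutWeight W m (p + q) {x} ≠ 4 := fun x hx hd =>
    hcon (h.orientable_of_degree_four hW hbig hsimple hx hd ih1)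
  have hnbr : ∀ x ∈ W, ∃ y ∈ W, x ≠ y ∧ 1 ≤ m x y := fun x hx => h.exists_neighbor hW hbig hx
  have hne : W.Nonempty := Finset.card_pos.1 (by omega)
  have hvert : ∀ x ∈ W, 4 + norm6 (b x) ≤ cutWeight W m (p + q) {x} ∧
      2 ∣ cutWeight W m (p + q) {x} - b x ∧ cutWeight W m (p + q) {x} ≠ 4 := fun x hx => by
    have hxW : {x} ⊆ W := by simpa using hx
    have h1 := h.cut {x} hxW (by simp) (fun e => by rw [← e] at hW; simp at hW)
    have h2 := h.parity {x} hxW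
    rw [Finset.sum_singleton] at h1 h2
    exact ⟨h1, h2, hfour x hx⟩
  have hdel : ∀ x ∈ W, ∀ y ∈ W, x ≠ y → 1 ≤ m x y →
      4 + norm6 (b x + 1) ≤ cutWeight W m (p + q) {x} - 1 →
      ¬ 4 + norm6 (b y - 1) ≤ cutWeight W m (p + q) {y} - 1 :=
    fun x hx y hy hxy hm h1 h2 => hcon <| h.orientable_of_delete hbig hx hy hxy hm
      (s := 0) (t := 0) (c := 0) (by simp) (by simpa using h.p_nonneg x hx)
      (by simpa using h.root) (by simpa using h1) h2 ih2
  -- `I` consists of the vertices that can afford to lose an incoming arc. Since no edge is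
  -- deletable, vertices outside `I` are tight with boundary 1 or 2, and those in `I` are tight with
  -- boundary -1 or -2. An edge between the two kinds would be deletable, so only one kind occurs.
  set I := W.filter fun x => 4 + norm6 (b x + 1) ≤ cutWeight W m (p + q) {x} - 1 with hI
  have hout : ∀ x ∈ W, x ∉ I → cutWeight W m (p + q) {x} = 4 + b x % 6 ∧
      (b x % 6 = 1 ∨ b x % 6 = 2) := by
    intro x hx hxI
    have h1 : ¬ 4 + norm6 (b x + 1) ≤ cutWeight W m (p + q) {x} - 1 := fun e =>
      hxI (Finset.mem_filter.2 ⟨hx, e⟩)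
    have h2 := hvert x hx
    unfold norm6 at h1 h2
    omega
  have hin : ∀ x ∈ I, cutWeight W m (p + q) {x} = 4 + (-b x) % 6 ∧
      ((-b x) % 6 = 1 ∨ (-b x) % 6 = 2) := by
    intro x hxI
    obtain ⟨hx, h1⟩ := Finset.mem_filter.1 hxI
    obtain ⟨y, hy, hxy, hm⟩ := hnbr x hx
    have h3 := hdel x hx y hy hxy hm h1
    have h4 : y ∈ I := by
      refine Finset.mem_filter.2 ⟨hy, ?_⟩
      have := hvert y hy
      unfold norm6 at this h3 ⊢
      omega
    have h5 := hdel y hy x hx hxy.symm (by rwa [h.symm]) (Finset.mem_filter.1 h4).2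
    have h6 := hvert x hx
    unfold norm6 at h5 h6
    omega
  by_cases hI0 : I.Nonempty
  · have hIW : I = W := by
      by_contra hIW
      obtain ⟨x, hx, y, hy, hm⟩ :=
        h.exists_edge_between (Finset.filter_subset ..) hI0 hIW
      obtain ⟨hyW, hyI⟩ := Finset.mem_sdiff.1 hy
      obtain ⟨hxW, h1⟩ := Finset.mem_filter.1 hx
      have h2 := hdel x hxW y hyW (fun e => hyI (e ▸ hx)) hm h1
      have h3 := hout y hyW hyI
      unfold norm6 at h2
      omega
    refine hcon (Orientable.of_neg (h.neg.orientable_of_positive hne (fun A hA hc hAW => ?_)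
      (fun x hx => ?_) hnbr fun m' p' q' b' hlt => ih2 m' p' q' b' ?_))
    · have := hbig A hA hc hAW
      rw [add_comm q p]
      simpa [norm6_neg] using this
    · rw [add_comm q p]
      exact hin x (hIW ▸ hx)
    · unfold edgeSize at hlt ⊢; omega
  · exact hcon (h.orientable_of_positive hne hbig
      (fun x hx => hout x hx fun e => hI0 ⟨x, e⟩) hnbr ih2)

end Induction

/-! ### From flows modulo 3 to integer flows. -/

theorem Relation.ReflTransGen.exists_head_avoiding {α : Type*} {r : α → α → Prop} {v w : α}
    (h : Relation.ReflTransGen r v w) (hvw : v ≠ w) :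
    ∃ u, r v u ∧ Relation.ReflTransGen (fun a b => r a b ∧ a ≠ v ∧ b ≠ v) u w := by
  induction h with
  | refl => exact absurd rfl hvw
  | @tail c w hc hcw ih =>
    by_cases hvc : v = c
    · subst hvc; exact ⟨w, hcw, .refl⟩
    · obtain ⟨u, hu, huc⟩ := ih hvc
      exact ⟨u, hu, huc.tail ⟨hcw, fun e => hvc e.symm, fun e => hvw e.symm⟩⟩

section IntegerFlow

variable {α E : Type*} [DecidableEq α] [Fintype E] (tail head : E → α)

/-- The net outflow of `f` at `v`. -/
def excess (f : E → ℤ) (v : α) : ℤ :=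
  ∑ e, f e * ((if tail e = v then 1 else 0) - if head e = v then 1 else 0)

/-- Some edge carries positive flow from `u` to `w`. -/
def FlowStep (f : E → ℤ) (u w : α) : Prop :=
  ∃ e, f e = 1 ∧ tail e = u ∧ head e = w ∨ f e = -2 ∧ head e = u ∧ tail e = w

theorem excess_update [DecidableEq E] (f : E → ℤ) (e : E) (t : ℤ) (v : α) :
    excess tail head (Function.update f e t) v = excess tail head f v +
      (t - f e) * ((if tail e = v then 1 else 0) - if head e = v then 1 else 0) := by
  unfold excess
  rw [← Finset.add_sum_erase _ _ (Finset.mem_univ e), Function.update_self,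
    ← Finset.add_sum_erase (a := e) Finset.univ (fun e => f e * _) (Finset.mem_univ e),
    Finset.sum_congr rfl fun i hi => by rw [Function.update_of_ne (Finset.ne_of_mem_erase hi)]]
  ring

theorem sum_excess (f : E → ℤ) (A : Finset α) : ∑ v ∈ A, excess tail head f v =
    ∑ e, f e * ((if tail e ∈ A then 1 else 0) - if head e ∈ A then 1 else 0) := by
  unfold excess
  rw [Finset.sum_comm]
  refine Finset.sum_congr rfl fun e _ => ?_
  rw [← Finset.mul_sum, Finset.sum_sub_distrib, Finset.sum_ite_eq, Finset.sum_ite_eq]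

/-- Exchanging 1 and -2 along a path moves three units of excess from its start to its end. The set
`T` collects the vertices already passed, so that no edge is changed twice. -/
theorem exists_flow_shift {V : Finset α} (hV : ∀ e, tail e ∈ V ∧ head e ∈ V) (T : Finset α)
    (f : E → ℤ) (hf : ∀ e, f e = 1 ∨ f e = -2) (v w : α)
    (h : Relation.ReflTransGen (fun a b => FlowStep tail head f a b ∧ a ∉ T ∧ b ∉ T) v w) :
    ∃ g : E → ℤ, (∀ e, g e = 1 ∨ g e = -2) ∧
      (∀ z, excess tail head g z =
        excess tail head f z - (if v = z then 3 else 0) + if w = z then 3 else 0) ∧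
      ∀ e, tail e ∈ T ∨ head e ∈ T → g e = f e := by
  classical
  induction hn : (V \ T).card using Nat.strong_induction_on generalizing T v with
  | _ n ih =>
  subst hn
  by_cases hvw : v = w
  · subst hvw; exact ⟨f, hf, fun z => by ring, fun _ _ => rfl⟩
  obtain ⟨u, ⟨⟨e, he⟩, hvT, huT⟩, hu⟩ := h.exists_head_avoiding hvw
  have hvV : v ∈ V := by
    rcases he with he | he
    · exact he.2.1 ▸ (hV e).1
    · exact he.2.1 ▸ (hV e).2
  obtain ⟨g, hg, hgx, hgT⟩ := ih (V \ insert v T).card (Finset.card_lt_card (by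
      rw [Finset.ssubset_iff_of_subset (Finset.sdiff_subset_sdiff subset_rfl
        (Finset.subset_insert v T))]
      exact ⟨v, by simp [hvV, hvT], by simp⟩)) (insert v T) u
    (Relation.ReflTransGen.mono (fun a b hab => ⟨hab.1.1, by simp [hab.1.2.1, hab.2.1], by simp [hab.1.2.2, hab.2.2]⟩) _ _ hu)
    rfl
  have hge : g e = f e := hgT e (by rcases he with he | he <;> simp [he])
  refine ⟨Function.update g e (-1 - f e), fun i => ?_, fun z => ?_, fun i hi => ?_⟩
  · by_cases h : i = e
    · subst h; rw [Function.update_self]; have := hf i; omega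
    · rw [Function.update_of_ne h]; exact hg i
  · rw [excess_update, hgx, hge]
    rcases he with ⟨h1, h2, h3⟩ | ⟨h1, h2, h3⟩ <;> rw [h1, h2, h3] <;> split_ifs <;> ring
  · have : i ≠ e := by
      rintro rfl
      rcases he with he | he <;> rw [he.2.1, he.2.2] at hi <;> tauto
    rw [Function.update_of_ne this]
    exact hgT i (by simp only [Finset.mem_insert]; tauto)

/-- Tutte: a flow modulo `3` with all values `1` can be changed to an integer flow with values
`1` and `-2`. -/
theorem exists_integer_flow {V : Finset α} (hV : ∀ e, tail e ∈ V ∧ head e ∈ V) (f : E → ℤ)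
    (hf : ∀ e, f e = 1 ∨ f e = -2) (h3 : ∀ v ∈ V, 3 ∣ excess tail head f v) :
    ∃ g : E → ℤ, (∀ e, g e = 1 ∨ g e = -2) ∧ ∀ v ∈ V, excess tail head g v = 0 := by
  classical
  induction hn : (∑ v ∈ V, |excess tail head f v|).toNat using Nat.strong_induction_on
    generalizing f with
  | _ n ih =>
  subst hn
  by_cases h0 : ∀ v ∈ V, excess tail head f v = 0
  · exact ⟨f, hf, h0⟩
  push Not at h0
  have hsum : ∑ v ∈ V, excess tail head f v = 0 := by
    rw [sum_excess]
    exact Finset.sum_eq_zero fun e _ => by rw [if_pos (hV e).1, if_pos (hV e).2]; ring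
  obtain ⟨v, hv, hv0⟩ := Finset.exists_pos_of_sum_zero_of_exists_nonzero _ hsum h0
  set R := V.filter fun u => Relation.ReflTransGen (FlowStep tail head f) v u with hR
  have hvR : v ∈ R := Finset.mem_filter.2 ⟨hv, .refl⟩
  -- No edge carries positive flow out of the reachable set `R`, so its total excess is not
  -- positive. As `v` has positive excess, some vertex of `R` has negative excess.
  have hneg : ∃ w ∈ R, excess tail head f w < 0 := by
    by_contra! hcon
    have h1 : 0 < ∑ u ∈ R, excess tail head f u := Finset.sum_pos' hcon ⟨v, hvR, hv0⟩
    refine h1.not_ge ?_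
    rw [sum_excess]
    refine Finset.sum_nonpos fun e _ => ?_
    rcases hf e with he | he
    · have : tail e ∈ R → head e ∈ R := fun h => Finset.mem_filter.2
        ⟨(hV e).2, (Finset.mem_filter.1 h).2.tail ⟨e, Or.inl ⟨he, rfl, rfl⟩⟩⟩
      rw [he]; split_ifs <;> tauto
    · have : head e ∈ R → tail e ∈ R := fun h => Finset.mem_filter.2
        ⟨(hV e).1, (Finset.mem_filter.1 h).2.tail ⟨e, Or.inr ⟨he, rfl, rfl⟩⟩⟩
      rw [he]; split_ifs <;> tauto
  obtain ⟨w, hw, hw0⟩ := hneg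
  obtain ⟨hwV, hvw⟩ := Finset.mem_filter.1 hw
  obtain ⟨g, hg, hgx, -⟩ := exists_flow_shift tail head hV ∅ f hf v w
    (Relation.ReflTransGen.mono (fun a b hab => ⟨hab, by simp, by simp⟩) _ _ hvw)
  have hne : v ≠ w := by rintro rfl; omega
  refine ih _ ?_ g hg (fun z hz => ?_) rfl
  · have h1 := h3 v hv
    -- Excesses are multiples of 3, so moving three units from a positive to a negative vertex
    -- brings both closer to 0.
    have hlt : ∑ z ∈ V, |excess tail head g z| < ∑ z ∈ V, |excess tail head f z| := by
      refine Finset.sum_lt_sum (fun z hz => ?_) ⟨v, hv, ?_⟩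
      · have := h3 z hz
        rw [hgx]
        split_ifs with h1 h2 h2
        · exact absurd (h1.trans h2.symm) hne
        · subst h1; simp only [abs_eq_max_neg]; omega
        · subst h2; simp only [abs_eq_max_neg]; omega
        · simp
      · rw [hgx, if_pos rfl, if_neg hne.symm]; simp only [abs_eq_max_neg]; omega
    have : 0 ≤ ∑ z ∈ V, |excess tail head g z| := Finset.sum_nonneg fun _ _ => abs_nonneg _
    omega
  · have := h3 z hz
    rw [hgx]; split_ifs <;> omega

end IntegerFlow

/-! ### Minimal sides of 5-edge-cuts, and the choice of the root. -/

section EdgeFamily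

variable {α E : Type*} [DecidableEq α] [Fintype E] (t h : E → α)

/-- The multiplicities of the graph whose edges have the ends `t e` and `h e`. -/
def edgeMul (x y : α) : ℤ := ∑ e, link (t e) (h e) x y

/-- The number of edges leaving `A`. -/
def cutCount (A : Finset α) : ℤ := ∑ e, if t e ∈ A ↔ h e ∈ A then 0 else 1

theorem sum_edgeMul {A B : Finset α} : ∑ x ∈ A, ∑ y ∈ B, edgeMul t h x y =
    ∑ e, ((if t e ∈ A ∧ h e ∈ B then 1 else 0) + if h e ∈ A ∧ t e ∈ B then 1 else 0) := by
  unfold edgeMul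
  rw [Finset.sum_congr rfl fun x _ => Finset.sum_comm, Finset.sum_comm]
  simp only [link, Finset.sum_add_distrib, sum_arc]

theorem sum_edgeMul_cut {V A : Finset α} (hV : ∀ e, t e ∈ V ∧ h e ∈ V) :
    ∑ x ∈ A, ∑ y ∈ V \ A, edgeMul t h x y = cutCount t h A := by
  rw [sum_edgeMul]
  refine Finset.sum_congr rfl fun e _ => ?_
  simp only [Finset.mem_sdiff, hV, true_and]
  by_cases h1 : t e ∈ A <;> by_cases h2 : h e ∈ A <;> simp [h1, h2]

theorem two_dvd_sum_edgeMul (A : Finset α) : 2 ∣ ∑ x ∈ A, ∑ y ∈ A, edgeMul t h x y := by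
  rw [sum_edgeMul]
  refine Finset.dvd_sum fun e _ => ?_
  by_cases h1 : t e ∈ A <;> by_cases h2 : h e ∈ A <;> simp [h1, h2]

theorem cutCount_empty : cutCount t h ∅ = 0 := by simp [cutCount]

theorem cutCount_univ {V : Finset α} (hV : ∀ e, t e ∈ V ∧ h e ∈ V) : cutCount t h V = 0 := by
  simp [cutCount, hV]

theorem cutCount_inter_add_union_le (A B : Finset α) :
    cutCount t h (A ∩ B) + cutCount t h (A ∪ B) ≤ cutCount t h A + cutCount t h B := by
  unfold cutCount
  simp only [← Finset.sum_add_distrib]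
  refine Finset.sum_le_sum fun e _ => ?_
  by_cases h1 : t e ∈ A <;> by_cases h2 : h e ∈ A <;> by_cases h3 : t e ∈ B <;>
    by_cases h4 : h e ∈ B <;> simp [h1, h2, h3, h4]

theorem cutCount_sdiff_add_sdiff_le (A B : Finset α) :
    cutCount t h (A \ B) + cutCount t h (B \ A) ≤ cutCount t h A + cutCount t h B := by
  unfold cutCount
  simp only [← Finset.sum_add_distrib]
  refine Finset.sum_le_sum fun e _ => ?_
  by_cases h1 : t e ∈ A <;> by_cases h2 : h e ∈ A <;> by_cases h3 : t e ∈ B <;>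
    by_cases h4 : h e ∈ B <;> simp [h1, h2, h3, h4]

theorem two_dvd_cutCount_union {A B : Finset α} (hd : Disjoint A B) :
    2 ∣ cutCount t h A + cutCount t h B - cutCount t h (A ∪ B) := by
  unfold cutCount
  simp only [← Finset.sum_add_distrib, ← Finset.sum_sub_distrib]
  refine Finset.dvd_sum fun e _ => ?_
  have h5 := @Finset.disjoint_left _ A B |>.1 hd
  have h6 := @h5 (t e)
  have h7 := @h5 (h e)
  by_cases h1 : t e ∈ A <;> by_cases h2 : h e ∈ A <;> by_cases h3 : t e ∈ B <;>
    by_cases h4 : h e ∈ B <;> simp [h1, h2, h3, h4] <;> simp_all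

theorem two_dvd_cutCount_inter (A B : Finset α) :
    2 ∣ cutCount t h (A ∩ B) + cutCount t h (A \ B) - cutCount t h A := by
  have := two_dvd_cutCount_union t h (Finset.disjoint_sdiff_inter A B).symm
  rwa [Finset.union_comm, Finset.sdiff_union_inter] at this

/-- In a `4`-edge-connected graph, two distinct inclusion-minimal sides of `5`-edge-cuts are
disjoint. -/
theorem disjoint_of_minimal_side {V : Finset α} (hV : ∀ e, t e ∈ V ∧ h e ∈ V)
    (h4 : ∀ A ⊆ V, A.Nonempty → A ≠ V → 4 ≤ cutCount t h A) {A B : Finset α}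
    (hA : Minimal (fun X => X ⊆ V ∧ cutCount t h X = 5) A)
    (hB : Minimal (fun X => X ⊆ V ∧ cutCount t h X = 5) B) (hAB : A ≠ B) : Disjoint A B := by
  have hodd : ∀ X ⊆ V, ¬ 2 ∣ cutCount t h X → 5 ≤ cutCount t h X := by
    intro X hX hdvd
    have := h4 X hX
      (by rw [Finset.nonempty_iff_ne_empty]; rintro rfl; simp [cutCount_empty] at hdvd)
      (by rintro rfl; simp [cutCount_univ t h hV] at hdvd)
    omega
  have hA5 := hA.prop.2
  have hB5 := hB.prop.2
  have p1 := two_dvd_cutCount_inter t h A B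
  have p2 := two_dvd_cutCount_inter t h B A
  rw [Finset.inter_comm] at p2
  have hI : A ∩ B ⊆ V := Finset.inter_subset_left.trans hA.prop.1
  -- Depending on parity, either both differences or both the intersection and the union have odd
  -- cuts. These are at least 5 each, so submodularity forces equality, and minimality applies.
  by_cases hpar : 2 ∣ cutCount t h (A ∩ B)
  · have d1 := hodd (A \ B) (Finset.sdiff_subset.trans hA.prop.1) (by omega)
    have d2 := hodd (B \ A) (Finset.sdiff_subset.trans hB.prop.1) (by omega)
    have := cutCount_sdiff_add_sdiff_le t h A B
    exact Finset.sdiff_eq_self_iff_disjoint.1 (Finset.Subset.antisymm Finset.sdiff_subset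
      (hA.le_of_le ⟨Finset.sdiff_subset.trans hA.prop.1, by omega⟩ Finset.sdiff_subset))
  · exfalso
    have p3 := two_dvd_cutCount_union t h (Finset.disjoint_sdiff (s := A) (t := B))
    rw [Finset.union_sdiff_self_eq_union] at p3
    have d1 := hodd (A ∩ B) hI hpar
    have d2 := hodd (A ∪ B) (Finset.union_subset hA.prop.1 hB.prop.1) (by omega)
    have := cutCount_inter_add_union_le t h A B
    have e1 := hA.le_of_le ⟨hI, by omega⟩ Finset.inter_subset_left
    have e2 := hB.le_of_le ⟨hI, by omega⟩ Finset.inter_subset_right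
    exact hAB (Finset.Subset.antisymm (e1.trans Finset.inter_subset_right)
      (e2.trans Finset.inter_subset_left))

/-- If at most seven edge sets are `5`-edge-cuts, seven vertices meet every side of each of
them. -/
theorem exists_transversal {V : Finset α} (hne : V.Nonempty) (hV : ∀ e, t e ∈ V ∧ h e ∈ V)
    (h4 : ∀ A ⊆ V, A.Nonempty → A ≠ V → 4 ≤ cutCount t h A) {β : Type*} (cut : Finset α → β)
    (hcut : ∀ A B, cut A = cut B → ∀ e, (t e ∈ A ↔ h e ∈ A) ↔ (t e ∈ B ↔ h e ∈ B))
    (hseven : {C | ∃ A ⊆ V, cutCount t h A = 5 ∧ C = cut A}.encard ≤ 7) :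
    ∃ v : Fin 7 → α, (∀ i, v i ∈ V) ∧ ∀ A ⊆ V, cutCount t h A = 5 → ∃ i, v i ∈ A := by
  classical
  set M := V.powerset.filter (Minimal fun X => X ⊆ V ∧ cutCount t h X = 5) with hM
  have hmin : ∀ A ∈ M, Minimal (fun X => X ⊆ V ∧ cutCount t h X = 5) A := fun A hA =>
    (Finset.mem_filter.1 hA).2
  have hnon : ∀ A ∈ M, A.Nonempty := fun A hA => by
    rw [Finset.nonempty_iff_ne_empty]; rintro rfl
    have := (hmin _ hA).prop.2
    simp [cutCount_empty] at this
  have hdisj : ∀ A ∈ M, ∀ B ∈ M, A ≠ B → Disjoint A B := fun A hA B hB =>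
    disjoint_of_minimal_side t h hV h4 (hmin A hA) (hmin B hB)
  have hcard : M.card ≤ 7 := by
    by_cases h2 : M.card ≤ 2
    · omega
    -- Two disjoint sides with the same cut have a union that no edge leaves. A third minimal side
    -- lies outside this union, contradicting connectivity. With only two minimal sides no
    -- injectivity is needed.
    have hinj : Set.InjOn cut M := by
      intro A hA B hB hc
      by_contra hAB
      obtain ⟨C, hC, hCAB⟩ : ∃ C ∈ M, C ∉ ({A, B} : Finset (Finset α)) :=
        Finset.exists_mem_notMem_of_card_lt_card (by
          have := Finset.card_le_two (a := A) (b := B); omega)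
      simp only [Finset.mem_insert, Finset.mem_singleton, not_or] at hCAB
      have hd := hdisj A hA B hB hAB
      have h0 : cutCount t h (A ∪ B) = 0 := by
        refine Finset.sum_eq_zero fun e _ => if_pos ?_
        have h1 := hcut A B hc e
        have h5 := @Finset.disjoint_left _ A B |>.1 hd
        have h6 := @h5 (t e)
        have h7 := @h5 (h e)
        simp only [Finset.mem_union]
        tauto
      have hAV := (hmin A hA).prop.1
      have hBV := (hmin B hB).prop.1
      obtain ⟨c, hc⟩ := hnon C hC
      have := h4 (A ∪ B) (Finset.union_subset hAV hBV)
        ((hnon A hA).mono Finset.subset_union_left) (fun e => by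
          have hcV : c ∈ A ∪ B := e ▸ (hmin C hC).prop.1 hc
          rcases Finset.mem_union.1 hcV with h | h
          · exact Finset.disjoint_left.1 (hdisj C hC A hA hCAB.1) hc h
          · exact Finset.disjoint_left.1 (hdisj C hC B hB hCAB.2) hc h)
      omega
    have h1 : (cut '' M).encard ≤ 7 := (Set.encard_le_encard (by
      rintro _ ⟨A, hA, rfl⟩
      exact ⟨A, (hmin A hA).prop.1, (hmin A hA).prop.2, rfl⟩)).trans hseven
    rw [hinj.encard_image, Set.encard_coe_eq_coe_finsetCard] at h1
    exact_mod_cast h1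
  obtain ⟨r, hr⟩ := hne
  choose rep hrep using fun A : Finset α => (by
    by_cases hA : A ∈ M
    · obtain ⟨x, hx⟩ := hnon A hA
      exact ⟨x, fun _ => hx⟩
    · exact ⟨r, fun h => absurd h hA⟩ : ∃ x, A ∈ M → x ∈ A)
  set l := (M.toList.map rep) with hl
  have hlV : ∀ x ∈ l, x ∈ V := by
    intro x hx
    obtain ⟨A, hA, rfl⟩ := List.mem_map.1 hx
    rw [Finset.mem_toList] at hA
    exact (hmin A hA).prop.1 (hrep A hA)
  -- The list is padded with the arbitrary vertex `r` to have exactly seven entries.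
  refine ⟨fun i => l.getD i r, fun i => ?_, fun A hA hA5 => ?_⟩
  · dsimp only
    by_cases hi : (i : ℕ) < l.length
    · rw [List.getD_eq_getElem _ _ hi]; exact hlV _ (List.getElem_mem hi)
    · rw [List.getD_eq_default _ _ (by omega)]; exact hr
  · obtain ⟨B, hBA, hB⟩ := Set.Finite.exists_le_minimal
      (s := {X | X ⊆ V ∧ cutCount t h X = 5})
      (Set.Finite.subset V.powerset.finite_toSet fun X hX => Finset.mem_powerset.2 hX.1)
      (a := A) ⟨hA, hA5⟩
    have hBM : B ∈ M := Finset.mem_filter.2 ⟨Finset.mem_powerset.2 hB.prop.1, hB⟩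
    obtain ⟨i, hi, he⟩ := List.mem_iff_getElem.1
      (List.mem_map.2 ⟨B, Finset.mem_toList.2 hBM, rfl⟩ : rep B ∈ l)
    refine ⟨⟨i, hi.trans_le (by simpa using hcard)⟩, ?_⟩
    dsimp only
    rw [List.getD_eq_getElem _ _ hi, he]
    exact hBA (hrep B hBM)

/-- A root joined by seven arcs, five out and two in, to vertices meeting all sides of
`5`-edge-cuts yields an orientation that is balanced modulo `3`. -/
theorem orientable_edgeMul {V : Finset α} (hV : ∀ e, t e ∈ V ∧ h e ∈ V) (hne : ∀ e, t e ≠ h e)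
    (h4 : ∀ A ⊆ V, A.Nonempty → A ≠ V → 4 ≤ cutCount t h A) (v : Fin 7 → α)
    (hv : ∀ i, v i ∈ V) (hv5 : ∀ A ⊆ V, cutCount t h A = 5 → ∃ i, v i ∈ A) :
    Orientable V (edgeMul t h) (fun x => 3 * ∑ y ∈ V, edgeMul t h x y) := by
  set p : α → ℤ := fun x => ∑ i : Fin 7, if i < 5 ∧ v i = x then 1 else 0 with hp
  set q : α → ℤ := fun x => ∑ i : Fin 7, if ¬ i < 5 ∧ v i = x then 1 else 0 with hq
  set deg : α → ℤ := fun x => 3 * ∑ y ∈ V, edgeMul t h x y with hdeg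
  have hps : ∀ A : Finset α, ∑ x ∈ A, p x = ∑ i : Fin 7, if i < 5 ∧ v i ∈ A then 1 else 0 :=
    fun A => by
      rw [Finset.sum_comm]
      refine Finset.sum_congr rfl fun i _ => ?_
      by_cases hi : i < 5 <;> simp [hi]
  have hqs : ∀ A : Finset α, ∑ x ∈ A, q x = ∑ i : Fin 7, if ¬ i < 5 ∧ v i ∈ A then 1 else 0 :=
    fun A => by
      rw [Finset.sum_comm]
      refine Finset.sum_congr rfl fun i _ => ?_
      by_cases hi : i < 5 <;> simp [hi]
  have hpV : ∑ x ∈ V, p x = 5 := by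
    rw [hps]; simp only [hv, and_true]; decide
  have hqV : ∑ x ∈ V, q x = 2 := by
    rw [hqs]; simp only [hv, and_true]; decide
  have hp0 : ∀ A : Finset α, 0 ≤ ∑ x ∈ A, p x := fun A => by
    rw [hps]; exact Finset.sum_nonneg fun i _ => by split_ifs <;> norm_num
  have hq0 : ∀ A : Finset α, 0 ≤ ∑ x ∈ A, q x := fun A => by
    rw [hqs]; exact Finset.sum_nonneg fun i _ => by split_ifs <;> norm_num
  have hpq : ∀ A ⊆ V, cutCount t h A = 5 → 1 ≤ ∑ x ∈ A, p x + ∑ x ∈ A, q x := by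
    intro A hA hA5
    obtain ⟨i, hi⟩ := hv5 A hA hA5
    rw [hps, hqs, ← Finset.sum_add_distrib]
    refine le_trans ?_ (Finset.single_le_sum (fun j _ => ?_) (Finset.mem_univ i))
    · by_cases hi5 : i < 5 <;> simp [hi5, hi]
    · split_ifs <;> norm_num
  have hsd : ∀ A ⊆ V, ∃ k, ∑ x ∈ A, deg x = 3 * cutCount t h A + 6 * k := by
    intro A hA
    obtain ⟨k, hk⟩ := two_dvd_sum_edgeMul t h A
    refine ⟨k, ?_⟩
    rw [hdeg, ← Finset.mul_sum, Finset.sum_congr rfl fun x _ => (Finset.sum_sdiff hA).symm,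
      Finset.sum_add_distrib, hk, sum_edgeMul_cut t h hV]
    ring
  have hb : ∀ A : Finset α, ∑ x ∈ A, (deg + q - p) x =
      ∑ x ∈ A, deg x + ∑ x ∈ A, q x - ∑ x ∈ A, p x := fun A => by
    simp [Finset.sum_add_distrib]
  have hcw : ∀ A, cutWeight V (edgeMul t h) (p + q) A =
      cutCount t h A + (∑ x ∈ A, p x + ∑ x ∈ A, q x) := fun A => by
    rw [cutWeight, sum_edgeMul_cut t h hV]; simp [Finset.sum_add_distrib]
  have hadm : Admissible V (edgeMul t h) p q (deg + q - p) := by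
    refine ⟨⟨fun x y => ?_, fun x => ?_, fun x y => ?_, fun x _ => ?_, fun x _ => ?_, ?_, ?_,
      fun A hA => ?_⟩, fun A hA hA0 hAV => ?_⟩
    · exact Finset.sum_congr rfl fun e _ => link_symm ..
    · exact Finset.sum_eq_zero fun e _ => link_diag (hne e) x
    · exact Finset.sum_nonneg fun e _ => link_nonneg ..
    · simpa using hp0 {x}
    · simpa using hq0 {x}
    · obtain ⟨k, hk⟩ := hsd V subset_rfl
      rw [hb, hk, cutCount_univ t h hV]
      omega
    · rw [hpV, hqV]; unfold norm6; norm_num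
    · obtain ⟨k, hk⟩ := hsd A hA
      rw [hb, hcw, hk]; omega
    -- For an even cut count the boundary has norm at most the number of root arcs at `A`. For count
    -- 5 at least one root arc meets `A`, which suffices; from 7 on the bound holds because `norm6`
    -- is at most 3.
    · obtain ⟨k, hk⟩ := hsd A hA
      have h1 := h4 A hA hA0 hAV
      have h2 := hpq A hA
      have h3 := hp0 A
      have h5 := hq0 A
      rw [hb, hcw, hk]
      unfold norm6
      omega
  have := hadm.orientable
  rwa [show deg + q - p - q + p = deg by ring] at this

/-- An orientation of the multiplicity matrix is realised by reversing some of the edges. -/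
theorem exists_reorientation {V : Finset α} (hV : ∀ e, t e ∈ V ∧ h e ∈ V)
    {c : α → ℤ} (ho : Orientable V (edgeMul t h) c) :
    ∃ T H : E → α, (∀ e, T e = t e ∧ H e = h e ∨ T e = h e ∧ H e = t e) ∧
      ∀ v ∈ V, 6 ∣ c v - excess T H (fun _ => 1) v := by
  classical
  obtain ⟨o, o0, o1, o2⟩ := ho
  set F : α → α → Finset E := fun x y => Finset.univ.filter fun e => t e = x ∧ h e = y with hF
  have hmul : ∀ x y, edgeMul t h x y = (F x y).card + (F y x).card := fun x y => by
    rw [hF, Finset.card_filter, Finset.card_filter, edgeMul]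
    push_cast
    rw [← Finset.sum_add_distrib]
    refine Finset.sum_congr rfl fun e _ => ?_
    simp only [link, arc, eq_comm, and_comm]
  -- `S x y` is the surplus of reference arcs from `x` to `y` over the prescribed number. Reversing
  -- it makes up the deficit in the opposite direction.
  have hsub : ∀ x y, ∃ S ⊆ F x y, x ∈ V → y ∈ V →
      (S.card : ℤ) = max 0 ((F x y).card - o x y) := fun x y => by
    by_cases hxy : x ∈ V ∧ y ∈ V
    · have := o0 x hxy.1 y hxy.2
      obtain ⟨S, hS, hc⟩ := Finset.exists_subset_card_eq
        (s := F x y) (n := (max 0 (((F x y).card : ℤ) - o x y)).toNat) (by omega)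
      exact ⟨S, hS, fun _ _ => by omega⟩
    · exact ⟨∅, by simp, fun h1 h2 => absurd ⟨h1, h2⟩ hxy⟩
  choose S hS hSc using hsub
  set R : E → Prop := fun e => e ∈ S (t e) (h e) with hR
  refine ⟨fun e => if R e then h e else t e, fun e => if R e then t e else h e, fun e => ?_,
    fun v hv => ?_⟩
  · by_cases he : R e <;> simp [he]
  · have hcount : ∀ x ∈ V, ∀ y ∈ V, x ≠ y → o x y =
        ∑ e, arc (if R e then h e else t e) (if R e then t e else h e) x y := by
      intro x hx y hy hxy
      have e1 : ∀ e, arc (if R e then h e else t e) (if R e then t e else h e) x y =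
          (if e ∈ F x y then 1 else 0) - (if e ∈ S x y then 1 else 0) +
            if e ∈ S y x then 1 else 0 := by
        intro e
        have m1 : e ∈ S x y → t e = x ∧ h e = y := fun he => (Finset.mem_filter.1 (hS x y he)).2
        have m2 : e ∈ S y x → t e = y ∧ h e = x := fun he => (Finset.mem_filter.1 (hS y x he)).2
        have m3 : e ∈ F x y ↔ t e = x ∧ h e = y := by simp [hF]
        by_cases c1 : t e = x ∧ h e = y
        · have n1 : e ∉ S y x := fun he => hxy (c1.1.symm.trans (m2 he).1)
          have hRe : R e ↔ e ∈ S x y := by simp only [hR, c1.1, c1.2]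
          rw [if_neg n1, if_pos (m3.2 c1)]
          by_cases hs : e ∈ S x y <;> simp [hRe, hs, c1.1, c1.2, arc, hxy]
        · have n1 : e ∉ S x y := fun he => c1 (m1 he)
          rw [if_neg (fun he => c1 (m3.1 he)), if_neg n1]
          by_cases c2 : t e = y ∧ h e = x
          · have hRe : R e ↔ e ∈ S y x := by simp only [hR, c2.1, c2.2]
            by_cases hs : e ∈ S y x <;> simp [hRe, hs, c2.1, c2.2, arc, hxy.symm]
          · have n2 : e ∉ S y x := fun he => c2 (m2 he)
            rw [if_neg n2, arc, if_neg]
            · rfl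
            · by_cases hs : R e <;> simp only [hs, if_true, if_false] <;> rintro ⟨rfl, rfl⟩ <;>
                simp at c1 c2
      rw [Finset.sum_congr rfl fun e _ => e1 e, Finset.sum_add_distrib, Finset.sum_sub_distrib]
      simp only [Finset.sum_boole, Finset.filter_univ_mem]
      have := hSc x y hx hy
      have := hSc y x hy hx
      have := o1 x hx y hy
      have := hmul x y
      omega
    convert o2 v hv using 2
    have e2 : ∀ y ∈ V, o v y - o y v = ∑ e,
        (arc (if R e then h e else t e) (if R e then t e else h e) v y -
          arc (if R e then h e else t e) (if R e then t e else h e) y v) := by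
      intro y hy
      by_cases hvy : v = y
      · subst hvy; simp
      · rw [hcount v hv y hy hvy, hcount y hy v hv (fun e => hvy e.symm),
          Finset.sum_sub_distrib]
    rw [Finset.sum_congr rfl e2, Finset.sum_comm, excess]
    refine Finset.sum_congr rfl fun e _ => ?_
    rw [sum_arc_row (by split_ifs; exacts [(hV e).2, (hV e).1])
      (by split_ifs; exacts [(hV e).1, (hV e).2]), one_mul]
    simp only [eq_comm]

end EdgeFamily

/-! ### Translation to `Graph`, and the main theorem. -/

namespace Graph

variable {α β : Type*}

/-- A reference orientation of `G`. -/
theorem exists_ends (G : Graph α β) : ∃ t h : E(G) → α, ∀ e : E(G), G.IsLink e (t e) (h e) := by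
  choose t h hth using fun e : E(G) => exists_isLink_of_mem_edgeSet e.2
  exact ⟨t, h, hth⟩

theorem edgeCut_eq_image [DecidableEq α] {G : Graph α β} {t h : E(G) → α}
    (hth : ∀ e : E(G), G.IsLink e (t e) (h e)) (A : Finset α) :
    G.edgeCut A = Subtype.val '' {e : E(G) | ¬ (t e ∈ A ↔ h e ∈ A)} := by
  ext e
  constructor
  · rintro ⟨x, hx, y, hy, he⟩
    refine ⟨⟨e, he.edge_mem⟩, ?_, rfl⟩
    have hx' : x ∈ A := hx
    have hy' : y ∉ A := hy.2
    rcases (hth ⟨e, he.edge_mem⟩).eq_and_eq_or_eq_and_eq he with ⟨h1, h2⟩ | ⟨h1, h2⟩ <;>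
      simp [h1, h2, hx', hy']
  · rintro ⟨e, he, rfl⟩
    have hl := hth e
    by_cases h1 : t e ∈ A
    · exact ⟨t e, h1, h e, ⟨hl.right_mem, fun h2 => he (by simp [h1, Finset.mem_coe.1 h2])⟩, hl⟩
    · have h2 : h e ∈ A := by
        by_contra h2
        exact he (by simp [h1, h2])
      exact ⟨h e, h2, t e, ⟨hl.left_mem, h1⟩, hl.symm⟩

theorem encard_edgeCut [DecidableEq α] {G : Graph α β} [Fintype E(G)] {t h : E(G) → α}
    (hth : ∀ e : E(G), G.IsLink e (t e) (h e)) (A : Finset α) {k : ℕ}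
    (hk : cutCount t h A = k) : (G.edgeCut A).encard = k := by
  have e1 : {e : E(G) | ¬ (t e ∈ A ↔ h e ∈ A)} =
      ((Finset.univ.filter fun e : E(G) => ¬ (t e ∈ A ↔ h e ∈ A) : Finset E(G)) : Set E(G)) := by
    ext; simp
  rw [edgeCut_eq_image hth, Subtype.val_injective.injOn.encard_image, e1,
    Set.encard_coe_eq_coe_finsetCard]
  have e2 : cutCount t h A =
      ((Finset.univ.filter fun e : E(G) => ¬ (t e ∈ A ↔ h e ∈ A)).card : ℤ) := by
    rw [cutCount, Finset.card_filter]
    push_cast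
    exact Finset.sum_congr rfl fun e _ => by by_cases h : (t e ∈ A ↔ h e ∈ A) <;> simp [h]
  rw [e2] at hk
  exact_mod_cast hk

/-- Once the edges of the cut are deleted, a walk starting in `A` cannot leave `A`. -/
theorem IsEdgeConnected.le_encard_edgeCut {G : Graph α β} {k : ℕ} (hG : G.IsEdgeConnected k)
    {A : Set α} (hA : A ⊆ V(G)) (hne : A.Nonempty) (hAV : A ≠ V(G)) :
    (k : ℕ∞) ≤ (G.edgeCut A).encard := by
  by_contra! hlt
  have hcon := hG (G.edgeCut A) (fun e ⟨_, _, _, _, he⟩ => he.edge_mem) hlt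
  obtain ⟨x, hx⟩ := hne
  obtain ⟨y, hy, hyA⟩ := Set.exists_of_ssubset (hA.ssubset_of_ne hAV)
  have hwalk := hcon.joined x (hA hx) y hy
  refine hyA ?_
  clear hy hyA
  induction hwalk with
  | refl => exact hx
  | tail _ hstep ih =>
    obtain ⟨e, he⟩ := hstep
    rw [deleteEdges_isLink] at he
    by_contra hb
    exact he.2 ⟨_, ih, _, ⟨he.1.right_mem, hb⟩, he.1⟩

end Graph

theorem theorem1p13 {α β : Type*} (G : Graph α β) [G.Loopless]
    (hV : V(G).Finite) (hE : E(G).Finite)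
    (hconn : G.IsEdgeConnected 4)
    (hcuts : (G.edgeCutsOfSize 5).encard ≤ 7) :
    ∃ (D : G.EdgeOrientation) (f : E(G) → ℤ), G.IsNowhereZeroThreeFlow D f := by
  classical
  have : Fintype E(G) := hE.fintype
  obtain ⟨t, h, hth⟩ := G.exists_ends
  set V := hV.toFinset with hVdef
  have hVc : (V : Set α) = V(G) := hV.coe_toFinset
  have hmem : ∀ {x}, x ∈ V ↔ x ∈ V(G) := hV.mem_toFinset
  have hends : ∀ e, t e ∈ V ∧ h e ∈ V := fun e =>
    ⟨hmem.2 (hth e).left_mem, hmem.2 (hth e).right_mem⟩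
  have hne : ∀ e, t e ≠ h e := fun e => (hth e).ne
  have hnn : ∀ A, 0 ≤ cutCount t h A := fun A =>
    Finset.sum_nonneg fun e _ => by split_ifs <;> norm_num
  have h4 : ∀ A ⊆ V, A.Nonempty → A ≠ V → 4 ≤ cutCount t h A := by
    intro A hA hA0 hAV
    obtain ⟨k, hk⟩ := Int.eq_ofNat_of_zero_le (hnn A)
    have h1 := hconn.le_encard_edgeCut (A := A) (hVc ▸ Finset.coe_subset.2 hA) (by simpa using hA0)
      (fun e => hAV (Finset.coe_injective (e.trans hVc.symm)))
    rw [Graph.encard_edgeCut hth A hk] at h1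
    rw [hk]
    exact_mod_cast h1
  have hV0 : V.Nonempty := by
    obtain ⟨x, hx⟩ := (hconn ∅ (Set.empty_subset _) (by simp)).nonempty
    exact ⟨x, hmem.2 hx⟩
  obtain ⟨v, hvV, hv5⟩ := exists_transversal t h hV0 hends h4 (fun A => G.edgeCut A)
    (fun A B hAB e => by
      have h1 : (e : β) ∈ G.edgeCut A ↔ (e : β) ∈ G.edgeCut B := by
        rw [show G.edgeCut A = G.edgeCut B from hAB]
      rw [Graph.edgeCut_eq_image hth, Graph.edgeCut_eq_image hth,
        Subtype.val_injective.mem_set_image, Subtype.val_injective.mem_set_image] at h1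
      exact not_iff_not.1 h1)
    ((Set.encard_le_encard (by
      rintro C ⟨A, hA, hA5, rfl⟩
      exact ⟨Graph.encard_edgeCut hth A hA5, A, hVc ▸ Finset.coe_subset.2 hA, rfl⟩)).trans hcuts)
  obtain ⟨T, H, hTH, hbal⟩ := exists_reorientation t h hends
    (orientable_edgeMul t h hends hne h4 v hvV hv5)
  have hTHV : ∀ e, T e ∈ V ∧ H e ∈ V := fun e => by
    rcases hTH e with ⟨h1, h2⟩ | ⟨h1, h2⟩ <;> rw [h1, h2]
    · exact hends e
    · exact (hends e).symm
  obtain ⟨g, hg, hg0⟩ := exists_integer_flow T H hTHV (fun _ => 1) (fun _ => Or.inl rfl)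
    (fun v hv => by have := hbal v hv; omega)
  refine ⟨⟨T, H, fun e => ?_⟩, g, fun e => ?_, fun v hv => ?_⟩
  · rcases hTH e with ⟨h1, h2⟩ | ⟨h1, h2⟩ <;> rw [h1, h2]
    · exact hth e
    · exact (hth e).symm
  · rcases hg e with h1 | h1 <;> simp [h1]
  · have h0 := hg0 v (hmem.2 hv)
    have key : ∀ F : E(G) → α, ∑ᶠ e ∈ {e | F e = v}, g e = ∑ e, if F e = v then g e else 0 := by
      intro F
      rw [← Finset.sum_filter, ← finsum_mem_coe_finset]
      simp
    rw [key, key]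
    simp only [excess, mul_sub, Finset.sum_sub_distrib, mul_ite, mul_one, mul_zero] at h0
    exact sub_eq_zero.1 h0
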